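/- Write $e(z)=e^{2\pi i z}$, $(f|_k\gamma)(z)=(cz+d)^{-k}f(\gamma z)$ for a real matrix $\gamma=\begin{pmatrix}a&b\\c&d\end{pmatrix}$ of determinant $1$, and $W_p=\begin{pmatrix}0&-p^{-1/2}\\p^{1/2}&0\end{pmatrix}$. There is a computable assignment to each prime $p>3$ of a set $\mathcal{Q}=\mathcal{Q}_p$ of $2\lfloor p/12\rfloor+3$ integers $q$ with $1\le q\le p-2$ such that the following holds. Let $k$ be an integer, let $\chi$ be a Dirichlet character modulo $p$ with $\chi(-1)=(-1)^k$, and let $(a_m)_{m\ge1}$, $(b_m)_{m\ge1}$ be complex sequences with $|a_m|,|b_m|=O(m^\sigma)$ for some $\sigma>0$. Put $f(z)=\sum_{m\ge1}a_m e(mz)$ and $g(z)=\sum_{m\ge1}b_m e(mz)$ for $\operatorname{Im} z>0$, and, for rational $x$ and $\operatorname{Re}s>\sigma+1$, $$\Lambda(f,x,s)=(2\pi)^{-s}\Gamma(s)\sum_{m\ge1}a_m e(mx)m^{-s},\qquad \Lambda(g,x,s)=(2\pi)^{-s}\Gamma(s)\sum_{m\ge1}b_m e(mx)m^{-s}.$$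 For $q\in\mathcal{Q}$ let $1\le q_\star\le p$ be the integer with $qq_\star\equiv-1\pmod p$. Then the following two statements are equivalent: (i) $f$ is a cusp form of weight $k$ for $\Gamma_0(p)$ with character $\chi$ (that is, $f$ is holomorphic on the upper half-plane, $f|_k\gamma=\chi(d)f$ for all $\gamma=\begin{pmatrix}a&b\\c&d\end{pmatrix}\in\Gamma_0(p)$, and $f$ vanishes at all cusps), and $f|_kW_p=g$; (ii) for every $q\in\mathcal{Q}$ the functions $\Lambda(f,\tfrac{-1}{q},s)$ and $\Lambda(g,\tfrac{(qq_\star+1)/p}{q},s)$ can be holomorphically continued to the whole complex plane, are bounded in every vertical strip, and satisfy $$\Lambda\Bigl(f,\frac{-1}{q},s\Bigr)=i^k\chi(q)\,(pq^2)^{\frac k2-s}\,\Lambda\Bigl(g,\frac{(qq_\star+1)/p}{q},k-s\Bigr).$$ -/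

import Mathlib

open Complex UpperHalfPlane
open scoped MatrixGroups ModularForm Manifold

noncomputable section

namespace AdditiveTwist

/-- `∑_{m ≥ 1} a_m e(mz)` on the upper half-plane, `e(z) = exp(2πiz)`. The value `a 0` plays no
role, here and below. -/
def fourierSeries (a : ℕ → ℂ) (z : ℍ) : ℂ :=
  ∑' m : ℕ+, a m * cexp (2 * Real.pi * Complex.I * (m : ℂ) * (z : ℂ))

/-- `|a_m| = O(m ^ σ)`. -/
def HasGrowth (a : ℕ → ℂ) (σ : ℝ) : Prop :=
  a =O[Filter.atTop] (fun m : ℕ => (m : ℝ) ^ σ)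

/-- The matrix `W_N` with rows `(0, -N^{-1/2})` and `(N^{1/2}, 0)`. -/
def frickeMatrix (N : ℕ) (hN : 0 < N) : SL(2, ℝ) :=
  ⟨!![0, -(Real.sqrt N)⁻¹; Real.sqrt N, 0], by
    have h : Real.sqrt N ≠ 0 := (Real.sqrt_pos.mpr (Nat.cast_pos.mpr hN)).ne'
    simp [Matrix.det_fin_two, h]⟩

/-- `f` is a cusp form of weight `k` for `Γ₀(N)` with character `χ`: it is holomorphic on the upper
half-plane, `f|_k γ = χ(d) f` for all `γ ∈ Γ₀(N)` with lower right entry `d`, and `f` vanishes at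
all cusps, that is, `(f|_k τ)(z) → 0` as `Im z → ∞` for every `τ ∈ SL₂(ℤ)`. -/
structure IsCuspFormWithChar (N : ℕ) (k : ℤ) (χ : DirichletCharacter ℂ N) (f : ℍ → ℂ) : Prop where
  holo : MDiff f
  slash_eq : ∀ γ ∈ CongruenceSubgroup.Gamma0 N,
    f ∣[k] γ = fun z => χ ((γ 1 1 : ℤ) : ZMod N) * f z
  zero_at_cusps : ∀ τ : SL(2, ℤ), IsZeroAtImInfty (f ∣[k] τ)

/-- The completed additive twist `Λ(a, x, s) = (2π)^{-s} Γ(s) ∑_{m ≥ 1} a_m e(mx) m^{-s}`, for `s`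
in the half-plane of absolute convergence. -/
def completedTwist (a : ℕ → ℂ) (x : ℚ) (s : ℂ) : ℂ :=
  (2 * Real.pi : ℂ) ^ (-s) * Gamma s *
    LSeries (fun m => a m * cexp (2 * Real.pi * Complex.I * (m : ℂ) * (x : ℂ))) s

/-- `F` is the holomorphic continuation to the whole complex plane of `Λ(a, x, s)`, which is a
priori defined for `Re s > σ + 1` only. -/
def IsEntireContinuation (a : ℕ → ℂ) (σ : ℝ) (x : ℚ) (F : ℂ → ℂ) : Prop :=
  Differentiable ℂ F ∧ ∀ s : ℂ, σ + 1 < s.re → F s = completedTwist a x s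

def BoundedInVerticalStrips (F : ℂ → ℂ) : Prop :=
  ∀ α β : ℝ, ∃ C : ℝ, ∀ s : ℂ, α ≤ s.re → s.re ≤ β → ‖F s‖ ≤ C

/-- The representative `q⋆` in `[1, p]` of the solution of `q q⋆ ≡ -1 (mod p)`. -/
def qStar (p q : ℕ) : ℕ := (-(q : ZMod p)⁻¹).val

theorem qStar_spec {p q : ℕ} (hp : p.Prime) (hq : 1 ≤ q) (hqp : q < p) :
    1 ≤ qStar p q ∧ qStar p q ≤ p ∧ (p : ℤ) ∣ q * qStar p q + 1 := by
  have : Fact p.Prime := ⟨hp⟩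
  have h0 : (q : ZMod p) ≠ 0 := by
    rw [Ne, ZMod.natCast_eq_zero_iff]
    exact fun h => absurd (Nat.le_of_dvd hq h) (by omega)
  refine ⟨?_, (ZMod.val_lt _).le, ?_⟩
  · rw [Nat.one_le_iff_ne_zero, qStar, Ne, ZMod.val_eq_zero]
    simpa using h0
  · rw [← ZMod.intCast_zmod_eq_zero_iff_dvd]
    push_cast
    rw [qStar, ZMod.natCast_zmod_val]
    simp [h0]

/-- The functions `Λ(f, -1/q, s)` and `Λ(g, ((q q⋆ + 1)/p)/q, s)` continue holomorphically to the
whole complex plane, the continuations are bounded in every vertical strip, and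
`Λ(f, -1/q, s) = i^k χ(q) (p q²)^{k/2 - s} Λ(g, ((q q⋆ + 1)/p)/q, k - s)`. -/
def TwistFunctionalEquation (p : ℕ) (k : ℤ) (χ : DirichletCharacter ℂ p) (a b : ℕ → ℂ) (σ : ℝ)
    (q : ℕ) : Prop :=
  ∃ F G : ℂ → ℂ,
    IsEntireContinuation a σ (-1 / (q : ℚ)) F ∧
    IsEntireContinuation b σ ((((q : ℚ) * qStar p q + 1) / p) / q) G ∧
    BoundedInVerticalStrips F ∧ BoundedInVerticalStrips G ∧
    ∀ s : ℂ, F s =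
      Complex.I ^ k * χ (q : ZMod p) * ((p : ℂ) * (q : ℂ) ^ 2) ^ ((k : ℂ) / 2 - s) * G (k - s)

/-- The finite sets `Q n` are computable from `n`: some computable function sends `n` to a list of
the elements of `Q n`. -/
def ComputableFinsets (Q : ℕ → Finset ℕ) : Prop :=
  ∃ L : ℕ → List ℕ, Computable L ∧ ∀ n, (L n).toFinset = Q n

end AdditiveTwist

end

/-!
The functional equation for `q` says, after Mellin inversion, that `f` and `g` are related by one
matrix, and the sets `Q_p` are chosen so that these matrices generate `Γ₀(p)`.

*Analysis.* Let `q q⋆ ≡ -1 (mod p)`, let `V_q ∈ Γ₀(p)` have the rows `(-q⋆, -1)` and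
`(q q⋆ + 1, q)` (`twistMatrix`), and put `N = p q²`. Slashing with `V_q W_p` carries the vertical
half-line over `((q q⋆ + 1)/p)/q` to the one over `-1/q` by `t ↦ 1/(Nt)`. So, by the identity
theorem, `f|V_q|W_p = χ(q) g` is equivalent to
`f(-1/q + i/(Nt)) = χ(q) (i √N t)^k g(((q q⋆ + 1)/p)/q + it)` for `t > 0`
(`slash_twistMatrix_eq_iff`). Taking Mellin transforms gives the functional equation
(`functionalEquation_of_relation`). Both sides are `O(t^{-A})` for all large `A`, in `t` as well as
in `1/t`, so no assumption on `k` is needed. Conversely (`relation_of_functionalEquation`), both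
sides are inverse Mellin transforms of the same entire function, along two different vertical
lines; the line of integration can be shifted, as a function that is bounded in the strip between
them and decays like `|t|⁻²` on its edges decays like `|t|⁻²` inside, by Phragmén–Lindelöf.

*Group theory.* Let `σ(x) = -1/x` and `ρ(x) = σ(x) + 1`, a map of order three on `ℙ¹(𝔽_p)` with the
orbit `{∞, 0, 1}`, and represent the elements of `𝔽_p^×` by `1, …, p - 1`. In `SL₂(ℤ)` one has
`V_{σ(q)} = -V_q⁻¹` and `V_q V_{ρ(q)} = V_{q - 1}`, up to factors with the rows `(1, 0)` and
`(pn, 1)`. Since `σ(q - 1)` is the third element of the `ρ`-orbit of `q`, this says that any two of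
the `V_x`, `x` in a `ρ`-orbit of three elements other than `{∞, 0, 1}`, give the third. Regard the
orbits as vertices and the pairs `{x, σ(x)}` as edges. The edge `{k - 1, σ(k - 1)}` connects the
orbits of `k - 1` and `k`; if `k` is the least element of an orbit with three elements, then it
connects that orbit to one with a smaller least element. These edges form a tree that contains all
the orbits with three elements, and the generators that belong to a tree can be recovered from the
others, leaf by leaf (`twistMatrix_mem_of_isOrbitMin`). So `Q_p` consists of the smaller elements
of the remaining pairs, and of `q = 1`, for which the functional equation amounts to `f|W_p = g`.
As the `V_q`, `-1` and `T` generate `Γ₀(p)` (`Gamma0_le_of_twists`), and `f|T = f` is clear, `f`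
transforms under `Γ₀(p)`. Its vanishing at the two cusps can be read off from the expansions of `f`
and `g = f|W_p`.

The number of elements of `Q_p` follows by counting the pairs and the orbits
(`card_twistSet`): the number of fixed points of `σ` is `0` or `2`, according to whether `-1` is a
square, and the number of fixed points of `ρ` is at most `2` and congruent to `p - 2` modulo `3`.
-/

namespace AdditiveTwist

/-! ### The set of twists -/

/-- For prime `p` and `2 ≤ k < p`, the orbit of `k` under the map `ρ : x ↦ 1 - 1/x` of order three
on `𝔽_p ∖ {0, 1}` has three elements, and `k` is the smallest of their representatives in
`[2, p - 1]`. The condition is written with remainders only, so that it is visibly primitive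
recursive: `(j * k + 1) % p = k` says `j = ρ(k)`, and `(j * k + 1) % p = j` says `k = ρ(j)`. -/
def IsOrbitMin (p k : ℕ) : Prop :=
  2 ≤ k ∧ k < p ∧ ∀ j < k + 1, (j * k + 1) % p ≠ k ∧ (j * k + 1) % p ≠ j

/-- Membership in the set of twists: `q = 1`, or `q` is the smaller element of a pair
`{q, -1/q}` that is different from `{k - 1, -1/(k - 1)}` for all orbit minima `k`. -/
def IsTwist (p q : ℕ) : Prop :=
  1 ≤ q ∧ (q = 1 ∨ (¬ IsOrbitMin p (q + 1) ∧
    ∀ j < p, (q * j + 1) % p = 0 → q ≤ j ∧ ¬ IsOrbitMin p (j + 1)))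

open Classical in
/-- The set `Q_p` of twists. -/
noncomputable def twistSet (p : ℕ) : Finset ℕ := (Finset.range p).filter (IsTwist p)

lemma primrecRel_isOrbitMin : PrimrecRel IsOrbitMin := by
  have hm : Primrec₂ fun (j : ℕ) (x : ℕ × ℕ) => (j * x.2 + 1) % x.1 :=
    Primrec.nat_mod.comp
      (Primrec.succ.comp (Primrec.nat_mul.comp Primrec.fst (Primrec.snd.comp Primrec.snd)))
      (Primrec.fst.comp Primrec.snd)
  have hR : PrimrecRel fun (j : ℕ) (x : ℕ × ℕ) =>
      (j * x.2 + 1) % x.1 ≠ x.2 ∧ (j * x.2 + 1) % x.1 ≠ j :=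
    ((Primrec.eq.comp hm (Primrec.snd.comp Primrec.snd)).not).and
      ((Primrec.eq.comp hm Primrec.fst).not)
  have hall : PrimrecPred fun x : ℕ × ℕ =>
      ∀ j < x.2 + 1, (j * x.2 + 1) % x.1 ≠ x.2 ∧ (j * x.2 + 1) % x.1 ≠ j :=
    (hR.forall_mem_list.comp (Primrec.list_range.comp (Primrec.succ.comp Primrec.snd))
      Primrec.id).of_eq fun x => by simp
  exact (Primrec.nat_le.comp (Primrec.const 2) Primrec.snd).and
    ((Primrec.nat_lt.comp Primrec.snd Primrec.fst).and hall)

lemma primrecRel_isTwist : PrimrecRel IsTwist := by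
  have hR : PrimrecRel fun (j : ℕ) (x : ℕ × ℕ) =>
      (x.2 * j + 1) % x.1 = 0 → x.2 ≤ j ∧ ¬ IsOrbitMin x.1 (j + 1) := by
    have h1 : PrimrecPred fun (y : ℕ × (ℕ × ℕ)) => ¬ (y.2.2 * y.1 + 1) % y.2.1 = 0 :=
      (Primrec.eq.comp (Primrec.nat_mod.comp
        (Primrec.succ.comp (Primrec.nat_mul.comp (Primrec.snd.comp Primrec.snd) Primrec.fst))
        (Primrec.fst.comp Primrec.snd)) (Primrec.const 0)).not
    have h2 : PrimrecPred fun (y : ℕ × (ℕ × ℕ)) => y.2.2 ≤ y.1 ∧ ¬ IsOrbitMin y.2.1 (y.1 + 1) :=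
      (Primrec.nat_le.comp (Primrec.snd.comp Primrec.snd) Primrec.fst).and
        ((primrecRel_isOrbitMin.comp (Primrec.fst.comp Primrec.snd)
          (Primrec.succ.comp Primrec.fst)).not)
    exact (h1.or h2).of_eq fun y => by tauto
  have hall : PrimrecPred fun x : ℕ × ℕ =>
      ∀ j < x.1, (x.2 * j + 1) % x.1 = 0 → x.2 ≤ j ∧ ¬ IsOrbitMin x.1 (j + 1) :=
    (hR.forall_mem_list.comp (Primrec.list_range.comp Primrec.fst) Primrec.id).of_eq
      fun x => by simp
  exact (Primrec.nat_le.comp (Primrec.const 1) Primrec.snd).and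
    ((Primrec.eq.comp Primrec.snd (Primrec.const 1)).or
      (((primrecRel_isOrbitMin.comp Primrec.fst (Primrec.succ.comp Primrec.snd)).not).and hall))

lemma computableFinsets_twistSet : ComputableFinsets twistSet := by
  classical
  have h : PrimrecRel fun q p => IsTwist p q := primrecRel_isTwist.swap
  refine ⟨fun p => (List.range p).filter fun q => IsTwist p q, ?_, fun p => ?_⟩
  · exact (h.listFilter.comp Primrec.list_range Primrec.id).to_comp
  · ext q
    simp [twistSet]

/-! ### The involution `x ↦ -1/x` and the map `x ↦ 1 - 1/x` of order three -/

section Residues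

variable {p : ℕ}

lemma natCast_ne_zero_of_lt {x : ℕ} (h1 : 1 ≤ x) (h2 : x < p) : (x : ZMod p) ≠ 0 := by
  rw [Ne, ZMod.natCast_eq_zero_iff]
  exact fun h => absurd (Nat.le_of_dvd h1 h) (by omega)

variable [hp : Fact p.Prime]

lemma eq_of_natCast_eq {x y : ℕ} (hx : x < p) (hy : y < p) (h : (x : ZMod p) = y) : x = y := by
  rw [← ZMod.val_cast_of_lt hx, ← ZMod.val_cast_of_lt hy, h]

lemma natCast_qStar (x : ℕ) : (qStar p x : ZMod p) = -(x : ZMod p)⁻¹ := by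
  rw [qStar, ZMod.natCast_zmod_val]

lemma qStar_lt (x : ℕ) : qStar p x < p := ZMod.val_lt _

lemma qStar_pos {x : ℕ} (h1 : 1 ≤ x) (h2 : x < p) : 1 ≤ qStar p x :=
  (qStar_spec hp.out h1 h2).1

lemma qStar_qStar {x : ℕ} (h2 : x < p) : qStar p (qStar p x) = x := by
  refine eq_of_natCast_eq (qStar_lt _) h2 ?_
  rw [natCast_qStar, natCast_qStar, inv_neg, inv_inv, neg_neg]

lemma qStar_one : qStar p 1 = p - 1 := by
  have := hp.out.two_le
  refine eq_of_natCast_eq (qStar_lt _) (by omega) ?_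
  rw [natCast_qStar, Nat.cast_sub (by omega)]
  simp

lemma mul_add_one_mod_eq_zero_iff {x y : ℕ} (h1 : 1 ≤ x) (h2 : x < p) (hy : y < p) :
    (x * y + 1) % p = 0 ↔ y = qStar p x := by
  have hx := natCast_ne_zero_of_lt h1 h2
  rw [← Nat.dvd_iff_mod_eq_zero, ← ZMod.natCast_eq_zero_iff]
  push_cast
  constructor
  · intro h
    refine eq_of_natCast_eq hy (qStar_lt _) ?_
    rw [natCast_qStar]
    field_simp
    linear_combination h
  · rintro rfl
    rw [natCast_qStar]
    field_simp
    ring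

lemma qStar_add_one_lt {x : ℕ} (h1 : 2 ≤ x) (h2 : x < p) : qStar p x + 1 < p := by
  have h3 := qStar_lt (p := p) x
  rcases Nat.lt_or_ge (qStar p x + 1) p with h | h
  · exact h
  · have h4 : qStar p x = qStar p 1 := by rw [qStar_one]; omega
    have h5 := congrArg (qStar p) h4
    rw [qStar_qStar h2, qStar_qStar (by omega)] at h5
    omega

lemma natCast_qStar_add_one {x : ℕ} (h1 : 1 ≤ x) (h2 : x < p) :
    ((qStar p x + 1 : ℕ) : ZMod p) = (x - 1) / x := by
  have hx := natCast_ne_zero_of_lt h1 h2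
  push_cast
  rw [natCast_qStar]
  field_simp
  ring

/-- The map `x ↦ 1 - 1/x` has order three. -/
lemma qStar_add_one_iterate {x : ℕ} (h1 : 2 ≤ x) (h2 : x < p) :
    qStar p (qStar p (qStar p x + 1) + 1) + 1 = x := by
  have b1 := qStar_add_one_lt h1 h2
  have c1 := qStar_pos (by omega) h2
  have b2 := qStar_add_one_lt (by omega) b1
  have c2 := qStar_pos (by omega) b1
  have b3 := qStar_add_one_lt (by omega) b2
  refine eq_of_natCast_eq b3 h2 ?_
  have hx := natCast_ne_zero_of_lt (by omega) h2
  have e1 := natCast_ne_zero_of_lt (by omega) b1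
  have e2 := natCast_ne_zero_of_lt (by omega) b2
  have f1 := natCast_qStar_add_one (by omega : 1 ≤ x) h2
  have f2 := natCast_qStar_add_one (by omega) b1
  have f3 := natCast_qStar_add_one (by omega) b2
  rw [f1] at f2 e1
  rw [f2] at f3 e2
  rw [f3]
  have e1' : (x : ZMod p) - 1 ≠ 0 := fun h => e1 (by rw [h, zero_div])
  field_simp
  ring

lemma mul_add_one_mod_eq_iff {j k : ℕ} (hk : 2 ≤ k) (hkp : k < p) (hj : j < p) :
    (j * k + 1) % p = k ↔ j = qStar p k + 1 := by
  have hx := natCast_ne_zero_of_lt (by omega : 1 ≤ k) hkp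
  have h0 : (j * k + 1) % p = k ↔ ((j * k + 1 : ℕ) : ZMod p) = (k : ℕ) := by
    rw [ZMod.natCast_eq_natCast_iff, Nat.ModEq, Nat.mod_eq_of_lt hkp]
  rw [h0]
  push_cast
  constructor
  · intro h
    refine eq_of_natCast_eq hj (qStar_add_one_lt hk hkp) ?_
    rw [natCast_qStar_add_one (by omega) hkp]
    field_simp
    linear_combination h
  · rintro rfl
    rw [natCast_qStar_add_one (by omega) hkp]
    field_simp
    ring

lemma mul_add_one_mod_eq_iff' {j k : ℕ} (hk : 2 ≤ k) (hkp : k < p) (hj : j < p) :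
    (j * k + 1) % p = j ↔ 2 ≤ j ∧ k = qStar p j + 1 := by
  rcases Nat.lt_or_ge j 2 with h | h
  · refine ⟨fun h' => ?_, fun h' => by omega⟩
    interval_cases j
    · rw [Nat.zero_mul, Nat.mod_eq_of_lt (by omega)] at h'
      omega
    · rcases Nat.lt_or_ge (k + 1) p with h3 | h3
      · rw [Nat.one_mul, Nat.mod_eq_of_lt h3] at h'
        omega
      · rw [show 1 * k + 1 = p by omega, Nat.mod_self] at h'
        omega
  · rw [mul_comm, mul_add_one_mod_eq_iff h hj hkp]
    exact ⟨fun h' => ⟨h, h'⟩, fun h' => h'.2⟩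

lemma isOrbitMin_iff {k : ℕ} (hk : 2 ≤ k) (hkp : k < p) :
    IsOrbitMin p k ↔ k < qStar p k + 1 ∧ k < qStar p (qStar p k + 1) + 1 := by
  have c1 := qStar_pos (by omega) hkp
  have b1 := qStar_add_one_lt hk hkp
  have b2 := qStar_add_one_lt (by omega) b1
  have c2 := qStar_pos (by omega) b1
  have h3 := qStar_add_one_iterate hk hkp
  constructor
  · rintro ⟨-, -, h⟩
    constructor
    · by_contra hc
      exact (h (qStar p k + 1) (by omega)).1 ((mul_add_one_mod_eq_iff hk hkp b1).2 rfl)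
    · by_contra hc
      exact (h (qStar p (qStar p k + 1) + 1) (by omega)).2
        ((mul_add_one_mod_eq_iff' hk hkp b2).2 ⟨by omega, h3.symm⟩)
  · rintro ⟨h1, h2⟩
    refine ⟨hk, hkp, fun j hj => ⟨fun h => ?_, fun h => ?_⟩⟩
    · rw [mul_add_one_mod_eq_iff hk hkp (by omega)] at h
      omega
    · rw [mul_add_one_mod_eq_iff' hk hkp (by omega)] at h
      obtain ⟨hj2, rfl⟩ := h
      rw [qStar_add_one_iterate hj2 (by omega)] at h2
      omega

lemma isTwist_iff {q : ℕ} (h1 : 1 ≤ q) (h2 : q < p) :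
    IsTwist p q ↔ q = 1 ∨
      (q ≤ qStar p q ∧ ¬ IsOrbitMin p (q + 1) ∧ ¬ IsOrbitMin p (qStar p q + 1)) := by
  refine ⟨?_, ?_⟩
  · rintro ⟨-, h | ⟨h3, h4⟩⟩
    · exact Or.inl h
    · have := h4 _ (qStar_lt q) ((mul_add_one_mod_eq_zero_iff h1 h2 (qStar_lt q)).2 rfl)
      exact Or.inr ⟨this.1, h3, this.2⟩
  · rintro (h | ⟨h3, h4, h5⟩)
    · exact ⟨h1, Or.inl h⟩
    · refine ⟨h1, Or.inr ⟨h4, fun j hj h => ?_⟩⟩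
      rw [mul_add_one_mod_eq_zero_iff h1 h2 hj] at h
      exact h ▸ ⟨h3, h5⟩

end Residues

end AdditiveTwist

namespace AdditiveTwist

/-! ### The number of twists -/

open Finset in
lemma card_add_card_fixed_eq {A : Finset ℕ} {f : ℕ → ℕ} (hA : ∀ x ∈ A, f x ∈ A)
    (hf : ∀ x ∈ A, f (f x) = x) :
    #A + #{x ∈ A | f x = x} = 2 * #{x ∈ A | x ≤ f x} := by
  have e1 : #{x ∈ A | x < f x} = #{x ∈ A | f x < x} := by
    refine card_nbij' f f ?_ ?_ ?_ ?_ <;> intro x hx <;>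
      simp only [coe_filter, Set.mem_ofPred_eq] at hx ⊢
    · exact ⟨hA x hx.1, by rw [hf x hx.1]; exact hx.2⟩
    · exact ⟨hA x hx.1, by rw [hf x hx.1]; exact hx.2⟩
    · exact hf x hx.1
    · exact hf x hx.1
  have e2 : #{x ∈ A | x ≤ f x} = #{x ∈ A | x < f x} + #{x ∈ A | f x = x} := by
    rw [← card_union_of_disjoint, ← filter_or]
    · congr 1
      ext x
      simp only [mem_filter]
      have : x ≤ f x ↔ x < f x ∨ f x = x := by omega
      tauto
    · exact disjoint_filter.2 fun x _ h => by omega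
  have e3 : #A = #{x ∈ A | x ≤ f x} + #{x ∈ A | f x < x} := by
    rw [← card_union_of_disjoint, ← filter_or]
    · congr 1
      ext x
      simp only [mem_filter]
      have := le_or_gt x (f x)
      tauto
    · exact disjoint_filter.2 fun x _ h => by omega
  omega

open Finset in
lemma card_eq_three_mul_add_card_fixed {A : Finset ℕ} {f : ℕ → ℕ} (hA : ∀ x ∈ A, f x ∈ A)
    (hf : ∀ x ∈ A, f (f (f x)) = x) :
    #A = 3 * #{x ∈ A | x < f x ∧ x < f (f x)} + #{x ∈ A | f x = x} := by
  have e1 : #{x ∈ A | x < f x ∧ x < f (f x)} = #{x ∈ A | f (f x) < x ∧ f (f x) < f x} := by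
    refine card_nbij' f (fun x => f (f x)) ?_ ?_ ?_ ?_ <;> intro x hx <;>
      simp only [coe_filter, Set.mem_ofPred_eq] at hx ⊢
    · exact ⟨hA x hx.1, by rw [hf x hx.1]; omega⟩
    · exact ⟨hA _ (hA x hx.1), by rw [hf x hx.1]; omega⟩
    · exact hf x hx.1
    · exact hf x hx.1
  have e2 : #{x ∈ A | x < f x ∧ x < f (f x)} = #{x ∈ A | f x < x ∧ f x < f (f x)} := by
    refine card_nbij' (fun x => f (f x)) f ?_ ?_ ?_ ?_ <;> intro x hx <;>
      simp only [coe_filter, Set.mem_ofPred_eq] at hx ⊢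
    · exact ⟨hA _ (hA x hx.1), by rw [hf x hx.1]; omega⟩
    · exact ⟨hA x hx.1, by rw [hf x hx.1]; omega⟩
    · exact hf x hx.1
    · exact hf x hx.1
  have e3 : A = ((({x ∈ A | x < f x ∧ x < f (f x)} ∪ {x ∈ A | f (f x) < x ∧ f (f x) < f x}) ∪
      {x ∈ A | f x < x ∧ f x < f (f x)}) ∪ {x ∈ A | f x = x}) := by
    ext x
    simp only [mem_union, mem_filter]
    constructor
    · intro hx
      have h3 := hf x hx
      have key : f (f x) = x → f x = x := fun h => by rwa [h] at h3
      have key2 : f (f x) = f x → f x = x := fun h => by rw [h, h] at h3; exact h3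
      simp only [hx, true_and]
      omega
    · tauto
  have d1 : Disjoint (filter (fun x => x < f x ∧ x < f (f x)) A)
      (filter (fun x => f (f x) < x ∧ f (f x) < f x) A) :=
    disjoint_filter.2 fun x _ h => by omega
  have d2 : Disjoint (filter (fun x => x < f x ∧ x < f (f x)) A ∪
      filter (fun x => f (f x) < x ∧ f (f x) < f x) A)
      (filter (fun x => f x < x ∧ f x < f (f x)) A) := by
    rw [← filter_or]
    exact disjoint_filter.2 fun x _ h => by omega
  have d3 : Disjoint ((filter (fun x => x < f x ∧ x < f (f x)) A ∪
      filter (fun x => f (f x) < x ∧ f (f x) < f x) A) ∪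
      filter (fun x => f x < x ∧ f x < f (f x)) A) (filter (fun x => f x = x) A) := by
    rw [← filter_or, ← filter_or]
    refine disjoint_filter.2 fun x _ h h' => ?_
    rw [h'] at h
    omega
  have e4 := congrArg card e3
  rw [card_union_of_disjoint d3, card_union_of_disjoint d2, card_union_of_disjoint d1] at e4
  omega

section Count

variable {p : ℕ} [hp : Fact p.Prime]

lemma qStar_eq_self_iff {x : ℕ} (h1 : 1 ≤ x) (h2 : x < p) :
    qStar p x = x ↔ (x : ZMod p) ^ 2 = -1 := by
  have hx := natCast_ne_zero_of_lt h1 h2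
  constructor
  · intro h
    have h3 := natCast_qStar (p := p) x
    rw [h] at h3
    nth_rw 1 [sq, h3]
    field_simp
  · intro h
    refine eq_of_natCast_eq (qStar_lt _) h2 ?_
    rw [natCast_qStar]
    field_simp
    linear_combination -h

lemma qStar_add_one_eq_self_iff {x : ℕ} (h1 : 2 ≤ x) (h2 : x < p) :
    qStar p x + 1 = x ↔ (x : ZMod p) ^ 2 - x + 1 = 0 := by
  have hx := natCast_ne_zero_of_lt (by omega) h2
  have h4 := natCast_qStar_add_one (p := p) (by omega) h2
  constructor
  · intro h
    rw [h] at h4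
    field_simp at h4
    linear_combination h4
  · intro h
    refine eq_of_natCast_eq (qStar_add_one_lt h1 h2) h2 ?_
    rw [h4]
    field_simp
    linear_combination -h

open Finset in
lemma card_fixed_qStar_le : #{x ∈ Icc 1 (p - 1) | qStar p x = x} ≤ 2 := by
  rcases eq_empty_or_nonempty {x ∈ Icc 1 (p - 1) | qStar p x = x} with h | ⟨x, hx⟩
  · rw [h]; simp
  refine le_trans (card_le_card (t := {x, p - x}) fun y hy => ?_) card_le_two
  simp only [mem_filter, mem_Icc, mem_insert, mem_singleton] at hx hy ⊢
  have hx2 := (qStar_eq_self_iff (p := p) (by omega) (by omega)).1 hx.2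
  have hy2 := (qStar_eq_self_iff (p := p) (by omega) (by omega)).1 hy.2
  have h : ((y : ZMod p) - x) * (y + x) = 0 := by linear_combination hy2 - hx2
  rcases mul_eq_zero.1 h with h | h
  · exact Or.inl (eq_of_natCast_eq (p := p) (by omega) (by omega) (sub_eq_zero.1 h))
  · right
    refine eq_of_natCast_eq (p := p) (by omega) (by omega) ?_
    rw [Nat.cast_sub (by omega), ZMod.natCast_self]
    linear_combination h

open Finset in
lemma card_fixed_qStar_add_one_le : #{x ∈ Icc 2 (p - 1) | qStar p x + 1 = x} ≤ 2 := by
  rcases eq_empty_or_nonempty {x ∈ Icc 2 (p - 1) | qStar p x + 1 = x} with h | ⟨x, hx⟩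
  · rw [h]; simp
  refine le_trans (card_le_card (t := {x, p + 1 - x}) fun y hy => ?_) card_le_two
  simp only [mem_filter, mem_Icc, mem_insert, mem_singleton] at hx hy ⊢
  have hx2 := (qStar_add_one_eq_self_iff (p := p) (by omega) (by omega)).1 hx.2
  have hy2 := (qStar_add_one_eq_self_iff (p := p) (by omega) (by omega)).1 hy.2
  have h : ((y : ZMod p) - x) * (y + x - 1) = 0 := by linear_combination hy2 - hx2
  rcases mul_eq_zero.1 h with h | h
  · exact Or.inl (eq_of_natCast_eq (p := p) (by omega) (by omega) (sub_eq_zero.1 h))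
  · right
    refine eq_of_natCast_eq (p := p) (by omega) (by omega) ?_
    rw [Nat.cast_sub (by omega), Nat.cast_add, ZMod.natCast_self]
    push_cast
    linear_combination h

open Finset in
/-- `-1` is a square modulo `p` exactly if `p % 4 ≠ 3`. -/
lemma card_fixed_qStar_pos_iff : 0 < #{x ∈ Icc 1 (p - 1) | qStar p x = x} ↔ p % 4 ≠ 3 := by
  rw [← ZMod.exists_sq_eq_neg_one_iff, card_pos]
  constructor
  · rintro ⟨x, hx⟩
    simp only [mem_filter, mem_Icc] at hx
    refine ⟨x, ?_⟩
    rw [← (qStar_eq_self_iff (p := p) (by omega) (by omega)).1 hx.2, sq]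
  · rintro ⟨y, hy⟩
    have hv := ZMod.val_lt y
    have h1 : 1 ≤ y.val := by
      rw [Nat.one_le_iff_ne_zero, Ne, ZMod.val_eq_zero]
      rintro rfl
      simp at hy
    refine ⟨y.val, ?_⟩
    simp only [mem_filter, mem_Icc]
    refine ⟨by omega, ?_⟩
    rw [qStar_eq_self_iff h1 hv, ZMod.natCast_zmod_val, hy, sq]

/-- Different orbit minima `k` give different pairs `{k - 1, -1/(k - 1)}`. -/
lemma IsOrbitMin.ne_qStar {k l : ℕ} (hk : IsOrbitMin p (k + 1)) (hl : IsOrbitMin p (l + 1))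
    (hkl : k ≠ l) : l ≠ qStar p k := by
  rintro rfl
  have hk2 := hk.1
  have hkp := hk.2.1
  have hl2 := hl.1
  have hlp := hl.2.1
  have hk1 : k ≠ 1 := by
    rintro rfl
    rw [qStar_one] at hlp
    omega
  have hl1 : qStar p k ≠ 1 := by
    intro h
    have h' := congrArg (qStar p) h
    rw [qStar_qStar (by omega), qStar_one] at h'
    omega
  have a1 := ((isOrbitMin_iff hl2 hlp).1 hl).2
  rw [qStar_add_one_iterate (by omega) (by omega)] at a1
  have a2 := ((isOrbitMin_iff hk2 hkp).1 hk).2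
  have a3 := qStar_add_one_iterate (p := p) (x := qStar p k) (by omega) (by omega)
  rw [qStar_qStar (by omega)] at a3
  omega

open Finset in
theorem card_twistSet (h3 : 3 < p) : (twistSet p).card = 2 * (p / 12) + 3 := by
  classical
  set P := {x ∈ Icc 1 (p - 1) | x ≤ qStar p x} with hP
  set M := {x ∈ Icc 2 (p - 1) | x < qStar p x + 1 ∧ x < qStar p (qStar p x + 1) + 1} with hM
  have hMmem : ∀ x, x ∈ M ↔ IsOrbitMin p x := by
    intro x
    simp only [hM, mem_filter, mem_Icc]
    constructor
    · rintro ⟨h, h'⟩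
      exact (isOrbitMin_iff (by omega) (by omega)).2 h'
    · intro h
      have h1 := h.1
      have h2 := h.2.1
      exact ⟨by omega, (isOrbitMin_iff h.1 h.2.1).1 h⟩
  have c2 := card_add_card_fixed_eq (A := Icc 1 (p - 1)) (f := qStar p)
    (fun x hx => by
      simp only [mem_Icc] at hx ⊢
      have := qStar_lt (p := p) x
      exact ⟨qStar_pos (by omega) (by omega), by omega⟩)
    (fun x hx => by
      simp only [mem_Icc] at hx
      exact qStar_qStar (by omega))
  have c3 := card_eq_three_mul_add_card_fixed (A := Icc 2 (p - 1)) (f := fun x => qStar p x + 1)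
    (fun x hx => by
      simp only [mem_Icc] at hx ⊢
      have := qStar_add_one_lt (p := p) (x := x) (by omega) (by omega)
      have := qStar_pos (p := p) (x := x) (by omega) (by omega)
      omega)
    (fun x hx => by
      simp only [mem_Icc] at hx
      exact qStar_add_one_iterate (by omega) (by omega))
  have l2 := card_fixed_qStar_le (p := p)
  have l3 := card_fixed_qStar_add_one_le (p := p)
  have m2 := card_fixed_qStar_pos_iff (p := p)
  simp only [Nat.card_Icc] at c2 c3
  rw [← hP] at c2
  rw [← hM] at c3
  -- the pairs `{k - 1, -1/(k - 1)}` with `k` an orbit minimum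
  set D := {q ∈ P | IsOrbitMin p (q + 1) ∨ IsOrbitMin p (qStar p q + 1)} with hD
  have cD : #M = #D := by
    refine card_nbij (fun k => min (k - 1) (qStar p (k - 1))) ?_ ?_ ?_
    · intro k hk
      rw [mem_coe, hMmem] at hk
      have h1 := hk.1
      have h2 := hk.2.1
      have h4 := qStar_lt (p := p) (k - 1)
      have h5 := qStar_pos (p := p) (x := k - 1) (by omega) (by omega)
      have h6 := qStar_qStar (p := p) (x := k - 1) (by omega)
      have h7 : k - 1 + 1 = k := by omega
      simp only [hD, hP, coe_filter, mem_filter, mem_Icc, Set.mem_ofPred_eq]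
      rcases le_total (k - 1) (qStar p (k - 1)) with h | h
      · rw [min_eq_left h, h7]
        exact ⟨⟨by omega, h⟩, Or.inl hk⟩
      · rw [min_eq_right h, h6, h7]
        exact ⟨⟨by omega, h⟩, Or.inr hk⟩
    · intro k hk l hl hkl
      rw [mem_coe, hMmem] at hk hl
      have h1 := hk.1
      have h2 := hk.2.1
      have h1' := hl.1
      have h2' := hl.2.1
      by_contra hne
      have hk' : IsOrbitMin p (k - 1 + 1) := by rwa [Nat.sub_add_cancel (by omega)]
      have hl' : IsOrbitMin p (l - 1 + 1) := by rwa [Nat.sub_add_cancel (by omega)]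
      have n1 := hk'.ne_qStar hl' (by omega)
      have n2 := hl'.ne_qStar hk' (by omega)
      have n3 : qStar p (k - 1) ≠ qStar p (l - 1) := fun h => by
        have h' := congrArg (qStar p) h
        rw [qStar_qStar (by omega), qStar_qStar (by omega)] at h'
        omega
      simp only at hkl
      omega
    · intro q hq
      simp only [hD, hP, coe_filter, mem_filter, mem_Icc, Set.mem_ofPred_eq] at hq
      obtain ⟨⟨⟨hq1, hq2⟩, hq3⟩, h | h⟩ := hq
      · refine ⟨q + 1, by rwa [mem_coe, hMmem], ?_⟩
        simpa using hq3
      · refine ⟨qStar p q + 1, by rwa [mem_coe, hMmem], ?_⟩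
        simp only [Nat.add_sub_cancel]
        rw [qStar_qStar (by omega)]
        exact min_eq_right hq3
  have hMin2 : IsOrbitMin p 2 := by
    have a : qStar p (p - 1) = 1 := by
      rw [← qStar_one (p := p), qStar_qStar (by omega)]
    have b := qStar_add_one_iterate (p := p) (x := p - 1) (by omega) (by omega)
    rw [a] at b
    have c := qStar_pos (p := p) (x := 2) (by omega) (by omega)
    have d : qStar p 2 ≠ 1 := by
      intro h
      rw [show 1 + 1 = 2 from rfl, h, show 1 + 1 = 2 from rfl, h] at b
      omega
    rw [isOrbitMin_iff le_rfl (by omega)]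
    refine ⟨by omega, ?_⟩
    rw [show 1 + 1 = 2 from rfl] at b
    rw [b]
    omega
  have hQ : twistSet p = insert 1 (P \ D) := by
    ext q
    simp only [twistSet, mem_filter, mem_range, mem_insert, mem_sdiff, hD, hP, mem_Icc]
    constructor
    · rintro ⟨h1, h2⟩
      have h4 := h2.1
      rw [isTwist_iff h4 h1] at h2
      rcases h2 with h | h
      · exact Or.inl h
      · exact Or.inr ⟨⟨by omega, h.1⟩, fun h' => by tauto⟩
    · rintro (rfl | h)
      · exact ⟨by omega, (isTwist_iff le_rfl (by omega)).2 (Or.inl rfl)⟩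
      · refine ⟨by omega, (isTwist_iff (by omega) (by omega)).2 (Or.inr ⟨h.1.2, ?_⟩)⟩
        have := h.1
        tauto
  have h1 : 1 ∉ P \ D := by
    rw [mem_sdiff, not_and_not_right]
    exact fun h => mem_filter.2 ⟨h, Or.inl hMin2⟩
  have hDP : D ⊆ P := filter_subset _ _
  have cPD := card_sdiff_add_card_eq_card hDP
  rw [hQ, card_insert_of_notMem h1]
  have p2 : p % 2 = 1 := by
    rcases hp.out.eq_two_or_odd with h | h <;> omega
  have p3 : p % 3 ≠ 0 := fun h => by
    have := (Nat.prime_dvd_prime_iff_eq Nat.prime_three hp.out).1 (Nat.dvd_of_mod_eq_zero h)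
    omega
  generalize #{x ∈ Icc 1 (p - 1) | qStar p x = x} = n₂ at *
  generalize #{x ∈ Icc 2 (p - 1) | qStar p x + 1 = x} = n₃ at *
  have hn₂ : n₂ = 0 ∨ n₂ = 2 := by omega
  have hn₃ : n₃ = 0 ∨ n₃ = 2 := by omega
  rcases hn₂ with rfl | rfl <;> rcases hn₃ with rfl | rfl <;> omega

lemma one_mem_twistSet : 1 ∈ twistSet p := by
  classical
  have := hp.out.two_le
  simp only [twistSet, Finset.mem_filter, Finset.mem_range]
  exact ⟨by omega, le_rfl, Or.inl rfl⟩

lemma bounds_of_mem_twistSet (h3 : 3 < p) {q : ℕ} (hq : q ∈ twistSet p) : 1 ≤ q ∧ q ≤ p - 2 := by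
  classical
  simp only [twistSet, Finset.mem_filter, Finset.mem_range] at hq
  obtain ⟨h1, h2⟩ := hq
  have h4 := h2.1
  refine ⟨h4, ?_⟩
  rcases (isTwist_iff h4 h1).1 h2 with h | h
  · omega
  · by_contra hc
    have h5 : q = qStar p 1 := by rw [qStar_one]; omega
    have h6 := h.1
    rw [h5, qStar_qStar (by omega), qStar_one] at h6
    omega

end Count

end AdditiveTwist

namespace AdditiveTwist

/-! ### Generators of `Γ₀(p)` -/

open Matrix ModularGroup CongruenceSubgroup

/-- The matrix with rows `(-i, -1)` and `(ij + 1, j)`. It lies in `Γ₀(p)` if `ij ≡ -1 (mod p)`, and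
equals `S T^j S T^{-i} S⁻¹`. -/
def twistMatrix (i j : ℤ) : SL(2, ℤ) :=
  ⟨!![-i, -1; i * j + 1, j], by simp [Matrix.det_fin_two]⟩

/-- The matrix with rows `(1, 0)` and `(n, 1)`. -/
def lowerUnipotent (n : ℤ) : SL(2, ℤ) := ⟨!![1, 0; n, 1], by simp [Matrix.det_fin_two]⟩

lemma coe_twistMatrix (i j : ℤ) :
    (twistMatrix i j : Matrix (Fin 2) (Fin 2) ℤ) = !![-i, -1; i * j + 1, j] := rfl

lemma coe_lowerUnipotent (n : ℤ) :
    (lowerUnipotent n : Matrix (Fin 2) (Fin 2) ℤ) = !![1, 0; n, 1] := rfl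

lemma twistMatrix_mem_Gamma0 {p : ℕ} {i j : ℤ} (h : (p : ℤ) ∣ i * j + 1) :
    twistMatrix i j ∈ Gamma0 p := by
  rw [Gamma0_mem, ZMod.intCast_zmod_eq_zero_iff_dvd]
  simpa [twistMatrix] using h

lemma twistMatrix_mul_swap (i j : ℤ) : twistMatrix i j * twistMatrix j i = -1 := by
  ext a b
  fin_cases a <;> fin_cases b <;> simp [coe_twistMatrix, Matrix.mul_apply] <;> ring

/-- The relation coming from `(ST)³ = -1`. -/
lemma twistMatrix_mul_twistMatrix (i i' j : ℤ) :
    twistMatrix i j * twistMatrix i' (i + 1) = twistMatrix (i' + 1) (j - 1) := by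
  ext a b
  fin_cases a <;> fin_cases b <;> simp [coe_twistMatrix, Matrix.mul_apply] <;> ring

lemma twistMatrix_mul_lowerUnipotent (i j n : ℤ) :
    twistMatrix i j * lowerUnipotent n = twistMatrix (i + n) j := by
  ext a b
  fin_cases a <;> fin_cases b <;>
    simp [coe_twistMatrix, coe_lowerUnipotent, Matrix.mul_apply] <;> ring

lemma lowerUnipotent_mul_twistMatrix (i j n : ℤ) :
    lowerUnipotent n * twistMatrix i j = twistMatrix i (j - n) := by
  ext a b
  fin_cases a <;> fin_cases b <;>
    simp [coe_twistMatrix, coe_lowerUnipotent, Matrix.mul_apply] <;> ring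

lemma T_mul_twistMatrix_one (p : ℤ) : T * twistMatrix (p - 1) 1 = lowerUnipotent p := by
  ext a b
  fin_cases a <;> fin_cases b <;>
    simp [coe_twistMatrix, coe_lowerUnipotent, Matrix.mul_apply, coe_T]

lemma lowerUnipotent_zpow (n m : ℤ) : lowerUnipotent n ^ m = lowerUnipotent (n * m) := by
  have hadd : ∀ a b : ℤ, lowerUnipotent a * lowerUnipotent b = lowerUnipotent (a + b) := by
    intro a b
    ext x y
    fin_cases x <;> fin_cases y <;> simp [coe_lowerUnipotent, Matrix.mul_apply]
  have h0 : lowerUnipotent 0 = 1 := by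
    ext x y
    fin_cases x <;> fin_cases y <;> simp [coe_lowerUnipotent]
  have hinv : ∀ a : ℤ, (lowerUnipotent a)⁻¹ = lowerUnipotent (-a) := fun a => by
    rw [inv_eq_iff_mul_eq_one, hadd, add_neg_cancel, h0]
  induction m with
  | zero => simp [h0]
  | succ m ih => rw [_root_.zpow_add_one, ih, hadd]; congr 1; ring
  | pred m ih => rw [_root_.zpow_sub_one, ih, hinv, hadd]; congr 1; ring

lemma coe_S_mul_T_zpow (j : ℤ) :
    ((S * T ^ j : SL(2, ℤ)) : Matrix (Fin 2) (Fin 2) ℤ) = !![0, -1; 1, j] := by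
  ext a b
  fin_cases a <;> fin_cases b <;> simp [coe_T_zpow, coe_S, Matrix.mul_apply]

lemma S_mul_T_zpow_mul_S (j : ℤ) : S * T ^ j * S = -lowerUnipotent (-j) := by
  refine Matrix.SpecialLinearGroup.ext _ _ fun a b => ?_
  rw [Matrix.SpecialLinearGroup.coe_mul, coe_S_mul_T_zpow]
  fin_cases a <;> fin_cases b <;> simp [coe_S, coe_lowerUnipotent, Matrix.mul_apply]

lemma S_mul_T_zpow_mul_S' (i j : ℤ) : S * T ^ j * S = twistMatrix i j * (S * T ^ i) := by
  refine Matrix.SpecialLinearGroup.ext _ _ fun a b => ?_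
  rw [Matrix.SpecialLinearGroup.coe_mul, coe_S_mul_T_zpow, Matrix.SpecialLinearGroup.coe_mul,
    coe_S_mul_T_zpow]
  fin_cases a <;> fin_cases b <;> simp [coe_S, coe_twistMatrix, Matrix.mul_apply]; ring

lemma S_inv_eq_neg : (S : SL(2, ℤ))⁻¹ = S * -1 := by
  rw [inv_eq_iff_mul_eq_one]
  ext a b
  fin_cases a <;> fin_cases b <;> simp [coe_S]

section Generation

variable {p : ℕ} {H : Subgroup SL(2, ℤ)}

lemma lowerUnipotent_mem (hL : lowerUnipotent p ∈ H) {n : ℤ} (hn : (p : ℤ) ∣ n) :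
    lowerUnipotent n ∈ H := by
  obtain ⟨m, rfl⟩ := hn
  rw [← lowerUnipotent_zpow]
  exact zpow_mem hL m

lemma twistMatrix_mem_of_modEq (hL : lowerUnipotent p ∈ H) {i j i' j' : ℤ}
    (h : twistMatrix i j ∈ H) (hi : (p : ℤ) ∣ i' - i) (hj : (p : ℤ) ∣ j - j') :
    twistMatrix i' j' ∈ H := by
  have h1 := mul_mem (mul_mem (lowerUnipotent_mem hL hj) h) (lowerUnipotent_mem hL hi)
  rw [lowerUnipotent_mul_twistMatrix, twistMatrix_mul_lowerUnipotent] at h1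
  convert h1 using 2 <;> ring

lemma twistMatrix_swap_mem (hneg : -1 ∈ H) {i j : ℤ} (h : twistMatrix i j ∈ H) :
    twistMatrix j i ∈ H := by
  have h1 : twistMatrix j i = (twistMatrix i j)⁻¹ * -1 := by
    rw [← twistMatrix_mul_swap i j, inv_mul_cancel_left]
  rw [h1]
  exact mul_mem (inv_mem h) hneg

variable [hp : Fact p.Prime]

lemma dvd_qStar_mul_add_one {k : ℕ} (h1 : 1 ≤ k) (h2 : k < p) :
    (p : ℤ) ∣ (qStar p k : ℤ) * k + 1 := by
  rw [mul_comm]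
  exact (qStar_spec hp.out h1 h2).2.2

lemma twistMatrix_qStar_mem_iff (hneg : -1 ∈ H) {k : ℕ} (hk : k < p) :
    twistMatrix (qStar p (qStar p k)) (qStar p k) ∈ H ↔ twistMatrix (qStar p k) k ∈ H := by
  rw [qStar_qStar hk]
  exact ⟨twistMatrix_swap_mem hneg, twistMatrix_swap_mem hneg⟩

/-- A subgroup containing two of the matrices attached to an orbit of `x ↦ 1 - 1/x` contains the
third. -/
lemma twistMatrix_pred_mem {k : ℕ} (h1 : 2 ≤ k) (h2 : k < p)
    (hk : twistMatrix (qStar p k) k ∈ H)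
    (hk' : twistMatrix (qStar p (qStar p k + 1)) (qStar p k + 1 : ℕ) ∈ H) :
    twistMatrix (qStar p (k - 1)) (k - 1 : ℕ) ∈ H := by
  have h3 := mul_mem hk hk'
  push_cast at h3
  rw [twistMatrix_mul_twistMatrix] at h3
  have h4 := qStar_add_one_lt h1 h2
  have h5 := qStar_pos (p := p) (by omega) h2
  have h6 := qStar_add_one_lt (p := p) (x := qStar p k + 1) (by omega) h4
  have h7 := qStar_add_one_iterate h1 h2
  have h8 : qStar p (k - 1) = qStar p (qStar p k + 1) + 1 := by
    rw [← h7, Nat.add_sub_cancel, h7, qStar_qStar h6]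
  rw [h8]
  push_cast [Nat.cast_sub (by omega : 1 ≤ k)]
  exact h3

lemma twistMatrix_mem_of_not_isOrbitMin (hneg : -1 ∈ H)
    (hQ : ∀ q ∈ twistSet p, twistMatrix (qStar p q) q ∈ H) {x : ℕ} (h1 : 1 ≤ x) (h2 : x < p)
    (h3 : ¬ IsOrbitMin p (x + 1)) (h4 : ¬ IsOrbitMin p (qStar p x + 1)) :
    twistMatrix (qStar p x) x ∈ H := by
  classical
  rcases le_total x (qStar p x) with h | h
  · refine hQ x ?_
    simp only [twistSet, Finset.mem_filter, Finset.mem_range]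
    exact ⟨h2, (isTwist_iff h1 h2).2 (Or.inr ⟨h, h3, h4⟩)⟩
  · rw [← twistMatrix_qStar_mem_iff hneg h2]
    refine hQ _ ?_
    have h5 := qStar_lt (p := p) x
    have h6 := qStar_pos h1 h2
    simp only [twistSet, Finset.mem_filter, Finset.mem_range]
    refine ⟨h5, (isTwist_iff h6 h5).2 (Or.inr ?_)⟩
    rw [qStar_qStar h2]
    exact ⟨h, h4, h3⟩

/-- The pairs left out of the set of twists are recovered one at a time, those belonging to larger
orbit minima first: the orbit of `k` consists of `k`, `ρ(k)` and `-1/(k - 1)`, and by minimality of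
`k` neither `k` nor `ρ(k)` belongs to a pair left out for an orbit minimum `≤ k`. -/
lemma twistMatrix_mem_of_isOrbitMin (hneg : -1 ∈ H)
    (hQ : ∀ q ∈ twistSet p, twistMatrix (qStar p q) q ∈ H) {k : ℕ} (hk : IsOrbitMin p k) :
    twistMatrix (qStar p (k - 1)) (k - 1 : ℕ) ∈ H := by
  induction hn : p - k using Nat.strong_induction_on generalizing k with
  | _ n ih =>
  have h1 := hk.1
  have h2 := hk.2.1
  have h3 := qStar_add_one_lt h1 h2
  have h4 := qStar_pos (p := p) (by omega) h2
  have hmin := (isOrbitMin_iff h1 h2).1 hk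
  have hiter := qStar_add_one_iterate h1 h2
  have key : ∀ y, k ≤ y → y < p → ¬ IsOrbitMin p (qStar p y + 1) →
      twistMatrix (qStar p y) y ∈ H := by
    intro y hy hyp hy'
    by_cases hm : IsOrbitMin p (y + 1)
    · have := hm.2.1
      have h5 := ih (p - (y + 1)) (by omega) hm rfl
      rwa [Nat.add_sub_cancel] at h5
    · exact twistMatrix_mem_of_not_isOrbitMin hneg hQ (by omega) hyp hm hy'
  refine twistMatrix_pred_mem h1 h2 (key k le_rfl h2 fun h => ?_)
    (key _ (by omega) h3 fun h => ?_)
  · have := ((isOrbitMin_iff h.1 h.2.1).1 h).2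
    omega
  · have := ((isOrbitMin_iff h.1 h.2.1).1 h).1
    omega

lemma twistMatrix_qStar_mem (hneg : -1 ∈ H)
    (hQ : ∀ q ∈ twistSet p, twistMatrix (qStar p q) q ∈ H) {x : ℕ} (h1 : 1 ≤ x) (h2 : x < p) :
    twistMatrix (qStar p x) x ∈ H := by
  by_cases h3 : IsOrbitMin p (x + 1)
  · simpa using twistMatrix_mem_of_isOrbitMin hneg hQ h3
  by_cases h4 : IsOrbitMin p (qStar p x + 1)
  · rw [← twistMatrix_qStar_mem_iff hneg h2]
    simpa using twistMatrix_mem_of_isOrbitMin hneg hQ h4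
  exact twistMatrix_mem_of_not_isOrbitMin hneg hQ h1 h2 h3 h4

lemma lowerUnipotent_mem_of_twists (hT : T ∈ H)
    (hQ : ∀ q ∈ twistSet p, twistMatrix (qStar p q) q ∈ H) : lowerUnipotent p ∈ H := by
  have h := hQ 1 one_mem_twistSet
  rw [qStar_one, Nat.cast_sub hp.out.one_le] at h
  rw [← T_mul_twistMatrix_one]
  exact mul_mem hT h

/-- A subgroup of `SL₂(ℤ)` that contains `-1`, `T` and the matrices of all twists meets every coset
of `Γ₀(p)`: every element of `SL₂(ℤ)` is in `H` or in `H S T^j` for some `j`. -/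
theorem mem_or_exists_eq_mul_S_mul_T_zpow (hneg : -1 ∈ H) (hT : T ∈ H)
    (hQ : ∀ q ∈ twistSet p, twistMatrix (qStar p q) q ∈ H) (τ : SL(2, ℤ)) :
    τ ∈ H ∨ ∃ h ∈ H, ∃ j : ℤ, τ = h * (S * T ^ j) := by
  have hL := lowerUnipotent_mem_of_twists hT hQ
  have hST : ∀ j : ℤ, S * T ^ j * S ∈ H ∨ ∃ h ∈ H, ∃ i : ℤ, S * T ^ j * S = h * (S * T ^ i) := by
    intro j
    by_cases hj : (p : ℤ) ∣ j
    · left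
      rw [S_mul_T_zpow_mul_S, ← mul_neg_one]
      exact mul_mem (lowerUnipotent_mem hL (by simpa using hj)) hneg
    · right
      have hp0 : (0 : ℤ) < p := by exact_mod_cast hp.out.pos
      have h0 := Int.emod_nonneg j hp0.ne'
      have h1 := Int.emod_lt_of_pos j hp0
      have h2 : j % p ≠ 0 := fun h => hj (Int.dvd_of_emod_eq_zero h)
      obtain ⟨x, hx⟩ := Int.eq_ofNat_of_zero_le h0
      have h3 := twistMatrix_qStar_mem hneg hQ (x := x) (by omega) (by omega)
      refine ⟨twistMatrix (qStar p x) j, ?_, qStar p x, S_mul_T_zpow_mul_S' _ _⟩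
      refine twistMatrix_mem_of_modEq hL h3 (by simp) ?_
      rw [← hx]
      exact (Int.modEq_iff_dvd.1 (Int.mod_modEq j p).symm)
  have hS : ∀ x : SL(2, ℤ), (x ∈ H ∨ ∃ h ∈ H, ∃ j : ℤ, x = h * (S * T ^ j)) →
      (x * S ∈ H ∨ ∃ h ∈ H, ∃ j : ℤ, x * S = h * (S * T ^ j)) := by
    rintro x (hx | ⟨h, hh, j, rfl⟩)
    · exact Or.inr ⟨x, hx, 0, by simp⟩
    · rw [mul_assoc]
      rcases hST j with h1 | ⟨h', hh', i, h1⟩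
      · exact Or.inl (mul_mem hh h1)
      · exact Or.inr ⟨h * h', mul_mem hh hh', i, by rw [h1, mul_assoc]⟩
  have hN : ∀ x : SL(2, ℤ), (x ∈ H ∨ ∃ h ∈ H, ∃ j : ℤ, x = h * (S * T ^ j)) →
      (x * -1 ∈ H ∨ ∃ h ∈ H, ∃ j : ℤ, x * -1 = h * (S * T ^ j)) := by
    rintro x (hx | ⟨h, hh, j, rfl⟩)
    · exact Or.inl (mul_mem hx hneg)
    · exact Or.inr ⟨h * -1, mul_mem hh hneg, j, by simp⟩
  have hTz : ∀ (n : ℤ) (x : SL(2, ℤ)), (x ∈ H ∨ ∃ h ∈ H, ∃ j : ℤ, x = h * (S * T ^ j)) →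
      (x * T ^ n ∈ H ∨ ∃ h ∈ H, ∃ j : ℤ, x * T ^ n = h * (S * T ^ j)) := by
    rintro n x (hx | ⟨h, hh, j, rfl⟩)
    · exact Or.inl (mul_mem hx (zpow_mem hT n))
    · exact Or.inr ⟨h, hh, j + n, by rw [_root_.zpow_add, mul_assoc, mul_assoc]⟩
  have hτ : τ ∈ Subgroup.closure {S, T} := by
    rw [SpecialLinearGroup.SL2Z_generators]
    exact Subgroup.mem_top τ
  induction hτ using Subgroup.closure_induction_right with
  | one => exact Or.inl (one_mem H)
  | mul_right x _ y hy ih =>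
    rcases hy with rfl | rfl
    · exact hS x ih
    · simpa using hTz 1 x ih
  | mul_inv_cancel x _ y hy ih =>
    rcases hy with rfl | rfl
    · rw [S_inv_eq_neg, ← mul_assoc]
      exact hN _ (hS x ih)
    · simpa using hTz (-1) x ih

/-- `Γ₀(p)` is generated by `-1`, `T` and the matrices of the twists. -/
theorem Gamma0_le_of_twists (hH : H ≤ Gamma0 p) (hneg : -1 ∈ H) (hT : T ∈ H)
    (hQ : ∀ q ∈ twistSet p, twistMatrix (qStar p q) q ∈ H) : Gamma0 p ≤ H := by
  intro γ hγ
  rcases mem_or_exists_eq_mul_S_mul_T_zpow hneg hT hQ γ with h | ⟨h, hh, j, rfl⟩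
  · exact h
  · have h1 : S * T ^ j ∈ Gamma0 p := by
      rwa [Subgroup.mul_mem_cancel_left _ (hH hh)] at hγ
    rw [Gamma0_mem, coe_S_mul_T_zpow] at h1
    simp at h1

end Generation

end AdditiveTwist

namespace AdditiveTwist

/-! ### Fourier series with coefficients of polynomial growth -/

open Filter Set Topology

/-- The series `∑_{m ≥ 1} a_m e(mz)` as a function of a complex variable. -/
noncomputable def fourierFun (a : ℕ → ℂ) (z : ℂ) : ℂ :=
  ∑' m : ℕ+, a m * cexp (2 * Real.pi * Complex.I * (m : ℂ) * z)

lemma fourierSeries_eq (a : ℕ → ℂ) (z : ℍ) : fourierSeries a z = fourierFun a z := rfl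

lemma HasGrowth.exists_norm_le {a : ℕ → ℂ} {σ : ℝ} (h : HasGrowth a σ) :
    ∃ C > 0, ∀ m : ℕ+, ‖a m‖ ≤ C * (m : ℝ) ^ σ := by
  obtain ⟨C, hC, hb⟩ := Asymptotics.bound_of_isBigO_nat_atTop h
  refine ⟨C, hC, fun m => ?_⟩
  have hm : (0 : ℝ) < (m : ℕ) := Nat.cast_pos.2 m.pos
  have h1 := hb (x := m) (Real.rpow_pos_of_pos hm σ).ne'
  rwa [Real.norm_of_nonneg (Real.rpow_nonneg hm.le σ)] at h1

lemma exists_exp_neg_le {A : ℝ} (hA : 0 ≤ A) :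
    ∃ C > 0, ∀ t : ℝ, 0 < t → Real.exp (-t) ≤ C * t ^ (-A) := by
  refine ⟨⌈A⌉₊.factorial, by positivity, fun t ht => ?_⟩
  rw [Real.rpow_neg ht.le, Real.exp_neg, ← div_eq_mul_inv, inv_eq_one_div,
    div_le_div_iff₀ (Real.exp_pos t) (Real.rpow_pos_of_pos ht A), one_mul]
  rcases le_total t 1 with h | h
  · have h1 : t ^ A ≤ 1 := Real.rpow_le_one ht.le h hA
    have h2 : (1 : ℝ) ≤ ⌈A⌉₊.factorial := by exact_mod_cast Nat.one_le_iff_ne_zero.2 (by positivity)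
    have h3 : 1 ≤ Real.exp t := Real.one_le_exp ht.le
    nlinarith
  · have h1 : t ^ A ≤ t ^ (⌈A⌉₊ : ℝ) := Real.rpow_le_rpow_of_exponent_le h (Nat.le_ceil A)
    have h2 := Real.pow_div_factorial_le_exp t ht.le ⌈A⌉₊
    rw [div_le_iff₀ (by positivity)] at h2
    rw [Real.rpow_natCast] at h1
    linarith

lemma norm_exp_two_pi_mul (m : ℕ+) (z : ℂ) :
    ‖cexp (2 * Real.pi * Complex.I * (m : ℂ) * z)‖ = Real.exp (-(2 * Real.pi * m * z.im)) := by
  rw [Complex.norm_exp]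
  congr 1
  simp

lemma summable_pnat_rpow {r : ℝ} (hr : r < -1) : Summable fun m : ℕ+ => (m : ℝ) ^ r :=
  (Real.summable_nat_rpow.2 hr).comp_injective PNat.coe_injective

/-- For every exponent `A > 0` the `m`-th term is `O(m^{σ - A} Im(z)^{-A})`. This one estimate gives
both the decay of the series as `Im z → ∞` and its polynomial growth as `Im z → 0`. -/
lemma HasGrowth.exists_norm_term_le {a : ℕ → ℂ} {σ A : ℝ} (h : HasGrowth a σ) (hA : 0 < A) :
    ∃ C > 0, ∀ (m : ℕ+) (z : ℂ), 0 < z.im →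
      ‖a m * cexp (2 * Real.pi * Complex.I * (m : ℂ) * z)‖ ≤
        C * (m : ℝ) ^ (σ - A) * z.im ^ (-A) := by
  obtain ⟨C, hC, hb⟩ := h.exists_norm_le
  obtain ⟨D, hD, he⟩ := exists_exp_neg_le hA.le
  refine ⟨C * D, by positivity, fun m z hz => ?_⟩
  have hm : (0 : ℝ) < (m : ℕ) := Nat.cast_pos.2 m.pos
  have h1 : Real.exp (-(2 * Real.pi * m * z.im)) ≤ D * ((m : ℝ) ^ (-A) * z.im ^ (-A)) := by
    rw [← Real.mul_rpow hm.le hz.le]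
    refine le_trans (Real.exp_le_exp.2 (neg_le_neg ?_)) (he _ (by positivity))
    have : 1 ≤ 2 * Real.pi := by linarith [Real.pi_gt_three]
    nlinarith [mul_pos hm hz]
  rw [norm_mul, norm_exp_two_pi_mul]
  calc ‖a m‖ * Real.exp (-(2 * Real.pi * m * z.im))
      ≤ (C * (m : ℝ) ^ σ) * (D * ((m : ℝ) ^ (-A) * z.im ^ (-A))) := by
        gcongr
        exact hb m
    _ = C * D * (m : ℝ) ^ (σ - A) * z.im ^ (-A) := by
        rw [sub_eq_add_neg, Real.rpow_add hm]
        ring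

lemma HasGrowth.summable_fourier {a : ℕ → ℂ} {σ : ℝ} (h : HasGrowth a σ) (hσ : 0 < σ) {z : ℂ}
    (hz : 0 < z.im) :
    Summable fun m : ℕ+ => a m * cexp (2 * Real.pi * Complex.I * (m : ℂ) * z) := by
  obtain ⟨C, -, hb⟩ := h.exists_norm_term_le (A := σ + 2) (by linarith)
  refine Summable.of_norm_bounded
    (((summable_pnat_rpow (r := σ - (σ + 2)) (by linarith)).mul_left C).mul_right _)
    fun m => hb m z hz

lemma HasGrowth.exists_norm_fourierFun_le {a : ℕ → ℂ} {σ A : ℝ} (h : HasGrowth a σ) (hσ : 0 < σ)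
    (hA : σ + 1 < A) : ∃ C > 0, ∀ z : ℂ, 0 < z.im → ‖fourierFun a z‖ ≤ C * z.im ^ (-A) := by
  obtain ⟨C, hC, hb⟩ := h.exists_norm_term_le (A := A) (by linarith)
  have hs := summable_pnat_rpow (r := σ - A) (by linarith)
  have hpos : 0 < ∑' m : ℕ+, (m : ℝ) ^ (σ - A) :=
    hs.tsum_pos (fun m => by positivity) 1 (by simp)
  refine ⟨C * ∑' m : ℕ+, (m : ℝ) ^ (σ - A), by positivity, fun z hz => ?_⟩
  rw [← tsum_mul_left, ← tsum_mul_right]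
  exact tsum_of_norm_bounded ((hs.mul_left C).mul_right _).hasSum fun m => hb m z hz

lemma HasGrowth.differentiableOn_fourierFun {a : ℕ → ℂ} {σ : ℝ} (h : HasGrowth a σ) (hσ : 0 < σ) :
    DifferentiableOn ℂ (fourierFun a) {z | 0 < z.im} := by
  intro z hz
  rw [mem_ofPred_eq] at hz
  obtain ⟨C, hC, hb⟩ := h.exists_norm_term_le (A := σ + 2) (by linarith)
  have hU : IsOpen {w : ℂ | z.im / 2 < w.im} := isOpen_lt continuous_const Complex.continuous_im
  have hd : DifferentiableOn ℂ (fourierFun a) {w | z.im / 2 < w.im} := by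
    refine Complex.differentiableOn_tsum_of_summable_norm
      (((summable_pnat_rpow (r := σ - (σ + 2)) (by linarith)).mul_left C).mul_right
        ((z.im / 2) ^ (-(σ + 2)))) (fun m => ?_) hU fun m w hw => ?_
    · exact Differentiable.differentiableOn (by fun_prop)
    · rw [mem_ofPred_eq] at hw
      refine (hb m w (by linarith)).trans ?_
      gcongr ?_ * ?_
      exact Real.rpow_le_rpow_of_nonpos (by linarith) hw.le (by linarith)
  exact (hd.differentiableAt (hU.mem_nhds (by rw [mem_ofPred_eq]; linarith))).differentiableWithinAt

lemma fourierFun_add_one (a : ℕ → ℂ) (z : ℂ) : fourierFun a (z + 1) = fourierFun a z := by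
  refine tsum_congr fun m => ?_
  rw [mul_add, Complex.exp_add]
  have : 2 * Real.pi * Complex.I * (m : ℂ) * 1 = (m : ℕ) * (2 * Real.pi * Complex.I) := by
    ring
  rw [this, Complex.exp_nat_mul_two_pi_mul_I, mul_one]

/-! ### The Mellin transform along a vertical half-line -/

/-- The restriction `t ↦ ∑ a_m e(m(x + it))` of a Fourier series to a vertical half-line. -/
noncomputable def verticalRestriction (a : ℕ → ℂ) (x : ℚ) (t : ℝ) : ℂ :=
  fourierFun a (x + t * Complex.I)

lemma HasGrowth.exists_norm_verticalRestriction_le {a : ℕ → ℂ} {σ A : ℝ} (h : HasGrowth a σ)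
    (hσ : 0 < σ) (hA : σ + 1 < A) (x : ℚ) :
    ∃ C > 0, ∀ t : ℝ, 0 < t → ‖verticalRestriction a x t‖ ≤ C * t ^ (-A) := by
  obtain ⟨C, hC, hb⟩ := h.exists_norm_fourierFun_le hσ hA
  refine ⟨C, hC, fun t ht => ?_⟩
  have h1 : ((x : ℂ) + t * Complex.I).im = t := by simp
  have h2 := hb (x + t * Complex.I) (by rwa [h1])
  rwa [h1] at h2

lemma HasGrowth.continuousOn_verticalRestriction {a : ℕ → ℂ} {σ : ℝ} (h : HasGrowth a σ)
    (hσ : 0 < σ) (x : ℚ) : ContinuousOn (verticalRestriction a x) (Ioi 0) := by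
  refine (h.differentiableOn_fourierFun hσ).continuousOn.comp
    (Continuous.continuousOn (by fun_prop)) fun t ht => ?_
  simpa using ht

lemma summable_norm_div_rpow {a : ℕ → ℂ} {σ r : ℝ} (h : HasGrowth a σ) (hr : σ + 1 < r) :
    Summable fun m : ℕ+ => ‖a m‖ / (m : ℝ) ^ r := by
  obtain ⟨C, hC, hb⟩ := h.exists_norm_le
  refine Summable.of_nonneg_of_le (fun m => by positivity) (fun m => ?_)
    ((summable_pnat_rpow (r := σ - r) (by linarith)).mul_left C)
  have hm : (0 : ℝ) < (m : ℕ) := Nat.cast_pos.2 m.pos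
  rw [Real.rpow_sub hm, ← mul_div_assoc]
  gcongr
  exact hb m

lemma LSeries_eq_tsum_pnat (f : ℕ → ℂ) (s : ℂ) : LSeries f s = ∑' m : ℕ+, f m / (m : ℂ) ^ s := by
  have h : Function.support (LSeries.term f s) ⊆ range ((↑) : ℕ+ → ℕ) := by
    intro n hn
    rcases Nat.eq_zero_or_pos n with rfl | h0
    · simp at hn
    · exact ⟨⟨n, h0⟩, rfl⟩
  rw [LSeries, ← PNat.coe_injective.tsum_eq h]
  exact tsum_congr fun m => LSeries.term_of_ne_zero m.ne_zero f s

lemma norm_twist (m : ℕ) (x : ℚ) :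
    ‖cexp (2 * Real.pi * Complex.I * (m : ℂ) * (x : ℂ))‖ = 1 := by
  rw [show 2 * Real.pi * Complex.I * (m : ℂ) * (x : ℂ) =
    ((2 * Real.pi * m * x : ℝ) : ℂ) * Complex.I by push_cast; ring, Complex.norm_exp_ofReal_mul_I]

lemma HasGrowth.mellin_verticalRestriction {a : ℕ → ℂ} {σ : ℝ} (h : HasGrowth a σ) (hσ : 0 < σ)
    (x : ℚ) {s : ℂ} (hs : σ + 1 < s.re) :
    mellin (verticalRestriction a x) s = completedTwist a x s := by
  have h2π : 0 < 2 * Real.pi := by positivity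
  have hsum := hasSum_mellin (ι := ℕ+)
    (a := fun m => a m * cexp (2 * Real.pi * Complex.I * (m : ℂ) * (x : ℂ)))
    (p := fun m => 2 * Real.pi * m) (F := verticalRestriction a x) (s := s)
    (fun m => Or.inr (by have : (0 : ℝ) < (m : ℕ) := Nat.cast_pos.2 m.pos
                         positivity)) (by linarith) ?_ ?_
  · rw [← hsum.tsum_eq, completedTwist, LSeries_eq_tsum_pnat, ← tsum_mul_left]
    refine tsum_congr fun m => ?_
    have hm : (0 : ℝ) < (m : ℕ) := Nat.cast_pos.2 m.pos
    rw [Complex.ofReal_mul, Complex.mul_cpow_ofReal_nonneg h2π.le hm.le, Complex.cpow_neg]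
    push_cast
    field_simp
  · intro t ht
    have h1 : 0 < ((x : ℂ) + t * Complex.I).im := by simpa using ht
    have h2 := (h.summable_fourier hσ h1).hasSum
    convert! h2 using 2 with m
    rw [mul_assoc]
    push_cast
    rw [← Complex.exp_add]
    congr 2
    linear_combination (-2 * Real.pi * (m : ℂ) * t : ℂ) * Complex.I_sq
  · simp only [norm_mul, norm_twist, mul_one]
    have h1 := (summable_norm_div_rpow h hs).mul_left ((2 * Real.pi) ^ s.re)⁻¹
    refine h1.congr fun m => ?_
    rw [Real.mul_rpow h2π.le (by positivity)]
    field_simp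

end AdditiveTwist

namespace AdditiveTwist

/-! ### Mellin transforms: convergence, bounds and the contour shift -/

open Filter Set Topology MeasureTheory

section Mellin

variable {φ : ℝ → ℂ} {A B C D : ℝ}

lemma mellinConvergent_of_norm_le (hφ : ContinuousOn φ (Ioi 0))
    (hA : ∀ t, 0 < t → ‖φ t‖ ≤ C * t ^ (-A)) (hB : ∀ t, 0 < t → ‖φ t‖ ≤ D * t ^ (-B))
    {s : ℂ} (h1 : A < s.re) (h2 : s.re < B) : MellinConvergent φ s := by
  refine mellinConvergent_of_isBigO_rpow (hφ.locallyIntegrableOn measurableSet_Ioi)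
    (Asymptotics.IsBigO.of_bound D ?_) h2 (Asymptotics.IsBigO.of_bound C ?_) h1
  · filter_upwards [eventually_gt_atTop 0] with t ht
    rw [Real.norm_of_nonneg (Real.rpow_nonneg ht.le _)]
    exact hB t ht
  · filter_upwards [self_mem_nhdsWithin] with t ht
    rw [mem_Ioi] at ht
    rw [Real.norm_of_nonneg (Real.rpow_nonneg ht.le _)]
    exact hA t ht

lemma differentiableAt_mellin_of_norm_le (hφ : ContinuousOn φ (Ioi 0))
    (hA : ∀ t, 0 < t → ‖φ t‖ ≤ C * t ^ (-A)) (hB : ∀ t, 0 < t → ‖φ t‖ ≤ D * t ^ (-B))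
    {s : ℂ} (h1 : A < s.re) (h2 : s.re < B) : DifferentiableAt ℂ (mellin φ) s := by
  refine mellin_differentiableAt_of_isBigO_rpow (hφ.locallyIntegrableOn measurableSet_Ioi)
    (Asymptotics.IsBigO.of_bound D ?_) h2 (Asymptotics.IsBigO.of_bound C ?_) h1
  · filter_upwards [eventually_gt_atTop 0] with t ht
    rw [Real.norm_of_nonneg (Real.rpow_nonneg ht.le _)]
    exact hB t ht
  · filter_upwards [self_mem_nhdsWithin] with t ht
    rw [mem_Ioi] at ht
    rw [Real.norm_of_nonneg (Real.rpow_nonneg ht.le _)]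
    exact hA t ht

lemma exists_norm_mellin_le {α β : ℝ} (hα : MellinConvergent φ α) (hβ : MellinConvergent φ β) :
    ∃ C : ℝ, ∀ s : ℂ, α ≤ s.re → s.re ≤ β → ‖mellin φ s‖ ≤ C := by
  have hnorm : ∀ (s : ℂ) (t : ℝ), 0 < t → ‖(t : ℂ) ^ (s - 1) • φ t‖ = t ^ (s.re - 1) * ‖φ t‖ := by
    intro s t ht
    rw [norm_smul, Complex.norm_cpow_eq_rpow_re_of_pos ht, Complex.sub_re, Complex.one_re]
  refine ⟨∫ t in Ioi (0 : ℝ), (‖(t : ℂ) ^ ((α : ℂ) - 1) • φ t‖ + ‖(t : ℂ) ^ ((β : ℂ) - 1) • φ t‖),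
    fun s h1 h2 => ?_⟩
  refine norm_integral_le_of_norm_le (hα.norm.add hβ.norm) ?_
  refine (ae_restrict_iff' measurableSet_Ioi).2 (Eventually.of_forall fun t ht => ?_)
  rw [mem_Ioi] at ht
  rw [hnorm _ _ ht, hnorm _ _ ht, hnorm _ _ ht, ← add_mul, Complex.ofReal_re, Complex.ofReal_re]
  gcongr
  have p1 : 0 < t ^ (α - 1) := Real.rpow_pos_of_pos ht _
  have p2 : 0 < t ^ (β - 1) := Real.rpow_pos_of_pos ht _
  rcases le_total t 1 with h | h
  · have := Real.rpow_le_rpow_of_exponent_ge ht h (show α - 1 ≤ s.re - 1 by linarith)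
    linarith
  · have := Real.rpow_le_rpow_of_exponent_le h (show s.re - 1 ≤ β - 1 by linarith)
    linarith

end Mellin

/-- The Mellin transform of `t ↦ ε (i √N t)^k ψ(t)`, compared with that of `t ↦ φ(1/(Nt))`. -/
lemma mellin_functional_equation {φ ψ : ℝ → ℂ} {N : ℝ} (hN : 0 < N) {ε : ℂ} {k : ℤ}
    (h : ∀ t : ℝ, 0 < t → φ (N * t)⁻¹ = ε * (Complex.I * Real.sqrt N * t) ^ k * ψ t) (s : ℂ) :
    mellin φ s = Complex.I ^ k * ε * (N : ℂ) ^ ((k : ℂ) / 2 - s) * mellin ψ (k - s) := by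
  have hN0 : (N : ℂ) ≠ 0 := Complex.ofReal_ne_zero.2 hN.ne'
  have e1 : mellin (fun t => φ (N * t)⁻¹) (-s) = (N : ℂ) ^ s • mellin φ s := by
    have := mellin_comp_mul_left (fun t => φ t⁻¹) (-s) hN
    rw [mellin_comp_inv, neg_neg] at this
    exact this
  have e2 : mellin (fun t => φ (N * t)⁻¹) (-s) =
      (ε * (Complex.I * Real.sqrt N) ^ k) • mellin ψ (k - s) := by
    have h3 : mellin (fun t => φ (N * t)⁻¹) (-s) =
        mellin (fun t => (ε * (Complex.I * Real.sqrt N) ^ k) • ((t : ℂ) ^ (k : ℂ) • ψ t)) (-s) := by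
      refine setIntegral_congr_fun measurableSet_Ioi fun t ht => ?_
      simp only
      rw [h t ht, mul_zpow _ (t : ℂ), Complex.cpow_intCast, smul_eq_mul, smul_eq_mul, smul_eq_mul,
        smul_eq_mul]
      ring
    rw [h3, mellin_const_smul, mellin_cpow_smul]
    congr 2
    ring
  have e3 : ((Real.sqrt N : ℝ) : ℂ) ^ k = (N : ℂ) ^ ((k : ℂ) / 2) := by
    rw [Real.sqrt_eq_rpow, ← Complex.cpow_intCast, Complex.ofReal_cpow hN.le, ← Complex.cpow_mul]
    · congr 1
      push_cast
      ring
    all_goals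
      rw [← Complex.ofReal_log hN.le, ← Complex.ofReal_mul, Complex.ofReal_im]
      linarith [Real.pi_pos]
  rw [e1, smul_eq_mul, smul_eq_mul, mul_zpow, e3] at e2
  rw [Complex.cpow_sub _ _ hN0]
  have hNs : (N : ℂ) ^ s ≠ 0 := by simp [Complex.cpow_eq_zero_iff, hN0]
  field_simp
  linear_combination e2

/-- Phragmén–Lindelöf: in a strip, boundedness of an entire function and decay of order `|t|⁻²` on
the two edges imply decay of order `|t|⁻²` throughout. -/
lemma exists_norm_le_div_one_add_sq {F : ℂ → ℂ} (hF : Differentiable ℂ F) {a b B C : ℝ}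
    (hab : a < b) (hC : 0 ≤ C) (hB : ∀ s : ℂ, a ≤ s.re → s.re ≤ b → ‖F s‖ ≤ B)
    (ha : ∀ s : ℂ, s.re = a → ‖F s‖ ≤ C / (1 + s.im ^ 2))
    (hb : ∀ s : ℂ, s.re = b → ‖F s‖ ≤ C / (1 + s.im ^ 2)) :
    ∃ D : ℝ, ∀ s : ℂ, a ≤ s.re → s.re ≤ b → ‖F s‖ ≤ D / (1 + s.im ^ 2) := by
  set L := b - a + 1 with hL
  have hL1 : 1 < L := by linarith
  have hlow : ∀ s : ℂ, a ≤ s.re → 1 + s.im ^ 2 ≤ ‖(s - a + 1) ^ 2‖ := by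
    intro s h1
    rw [norm_pow, ← Complex.normSq_eq_norm_sq, Complex.normSq_apply]
    simp
    nlinarith
  have hup : ∀ s : ℂ, a ≤ s.re → s.re ≤ b → ‖(s - a + 1) ^ 2‖ ≤ L ^ 2 * (1 + s.im ^ 2) := by
    intro s h1 h2
    rw [norm_pow, ← Complex.normSq_eq_norm_sq, Complex.normSq_apply]
    simp
    have h3 : (s.re - a + 1) * (s.re - a + 1) ≤ L * L := by gcongr <;> linarith
    nlinarith [mul_nonneg (by nlinarith : 0 ≤ L * L - 1) (sq_nonneg s.im)]
  have hedge : ∀ s : ℂ, a ≤ s.re → s.re ≤ b → ‖F s‖ ≤ C / (1 + s.im ^ 2) →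
      ‖F s * (s - a + 1) ^ 2‖ ≤ C * L ^ 2 := by
    intro s h1 h2 h3
    rw [norm_mul]
    have h4 : 0 < 1 + s.im ^ 2 := by positivity
    calc ‖F s‖ * ‖(s - a + 1) ^ 2‖ ≤ C / (1 + s.im ^ 2) * (L ^ 2 * (1 + s.im ^ 2)) := by
          gcongr
          exact hup s h1 h2
      _ = C * L ^ 2 := by field_simp
  refine ⟨C * L ^ 2, fun s h1 h2 => ?_⟩
  have h3 : ‖F s * (s - a + 1) ^ 2‖ ≤ C * L ^ 2 := by
    refine PhragmenLindelof.vertical_strip (f := fun s => F s * (s - a + 1) ^ 2) (a := a) (b := b)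
      (Differentiable.diffContOnCl (by fun_prop)) ?_
      (fun z hz => hedge z hz.ge (by linarith) (ha z hz))
      (fun z hz => hedge z (by linarith) hz.le (hb z hz)) h1 h2
    set c := Real.pi / (b - a) / 2 with hc
    have hc0 : 0 < c := by have : 0 < b - a := by linarith
                           positivity
    refine ⟨c, ?_, 1, ?_⟩
    · have : 0 < Real.pi / (b - a) := div_pos Real.pi_pos (by linarith)
      linarith
    · refine Asymptotics.IsBigO.of_bound (B * L ^ 2 * (1 + 2 / c ^ 2)) ?_
      rw [eventually_inf_principal]
      refine Eventually.of_forall fun z hz => ?_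
      have hz' : z.re ∈ Ioo a b := hz
      rw [one_mul, Real.norm_of_nonneg (Real.exp_pos _).le, norm_mul]
      have hB' := hB z hz'.1.le hz'.2.le
      have h5 : 1 + z.im ^ 2 ≤ (1 + 2 / c ^ 2) * Real.exp (c * |z.im|) := by
        have h6 := Real.pow_div_factorial_le_exp (c * |z.im|) (by positivity) 2
        have h7 : 1 ≤ Real.exp (c * |z.im|) := Real.one_le_exp (by positivity)
        have h8 : z.im ^ 2 = 2 / c ^ 2 * ((c * |z.im|) ^ 2 / (Nat.factorial 2 : ℕ)) := by
          rw [mul_pow, sq_abs]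
          push_cast [Nat.factorial]
          field_simp
        rw [h8, add_mul, one_mul]
        gcongr
      have h9 : Real.exp (c * |z.im|) ≤ Real.exp (Real.exp (c * |z.im|)) :=
        Real.exp_le_exp.2 (by linarith [Real.add_one_le_exp (c * |z.im|)])
      have hB0 : 0 ≤ B := (norm_nonneg _).trans hB'
      calc ‖F z‖ * ‖(z - a + 1) ^ 2‖ ≤ B * (L ^ 2 * (1 + z.im ^ 2)) := by
            gcongr
            exact hup z hz'.1.le hz'.2.le
        _ ≤ B * (L ^ 2 * ((1 + 2 / c ^ 2) * Real.exp (Real.exp (c * |z.im|)))) := by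
            gcongr
            exact h5.trans (by gcongr)
        _ = _ := by ring
  rw [norm_mul] at h3
  rw [le_div_iff₀ (by positivity)]
  exact le_trans (by gcongr; exact hlow s h1) h3

lemma verticalIntegrable_of_norm_le {F : ℂ → ℂ} (hF : Differentiable ℂ F) {a D : ℝ}
    (ha : ∀ s : ℂ, s.re = a → ‖F s‖ ≤ D / (1 + s.im ^ 2)) : VerticalIntegrable F a := by
  refine Integrable.mono' (integrable_inv_one_add_sq.const_mul D)
    (hF.continuous.comp (by fun_prop : Continuous fun y : ℝ => (a : ℂ) + y * Complex.I)
      |>.aestronglyMeasurable) (Eventually.of_forall fun y => ?_)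
  have := ha (a + y * Complex.I) (by simp)
  simpa [div_eq_mul_inv] using this

/-- Shift of the line of integration. -/
lemma mellinInv_eq_mellinInv {F : ℂ → ℂ} (hF : Differentiable ℂ F) {a b D : ℝ} (hab : a < b)
    (hD : ∀ s : ℂ, a ≤ s.re → s.re ≤ b → ‖F s‖ ≤ D / (1 + s.im ^ 2)) {x : ℝ} (hx : 0 < x) :
    mellinInv a F x = mellinInv b F x := by
  have hx0 : (x : ℂ) ≠ 0 := Complex.ofReal_ne_zero.2 hx.ne'
  set G : ℂ → ℂ := fun s => (x : ℂ) ^ (-s) * F s with hG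
  have hGd : Differentiable ℂ G := fun s =>
    ((differentiableAt_id.neg.const_cpow (Or.inl hx0))).mul (hF s)
  obtain ⟨E, hE⟩ : ∃ E : ℝ, ∀ s : ℂ, a ≤ s.re → s.re ≤ b → ‖G s‖ ≤ E / (1 + s.im ^ 2) := by
    refine ⟨(x ^ (-a) + x ^ (-b)) * D, fun s h1 h2 => ?_⟩
    rw [hG, norm_mul, Complex.norm_cpow_eq_rpow_re_of_pos hx, Complex.neg_re, mul_div_assoc]
    have p1 : 0 < x ^ (-a) := Real.rpow_pos_of_pos hx _
    have p2 : 0 < x ^ (-b) := Real.rpow_pos_of_pos hx _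
    refine mul_le_mul ?_ (hD s h1 h2) (norm_nonneg _) (by positivity)
    rcases le_total x 1 with h | h
    · have := Real.rpow_le_rpow_of_exponent_ge hx h (show -b ≤ -s.re by linarith)
      linarith
    · have := Real.rpow_le_rpow_of_exponent_le h (show -s.re ≤ -a by linarith)
      linarith
  have hint : ∀ c ∈ Icc a b, Integrable fun y : ℝ => G (c + y * Complex.I) := fun c hc =>
    verticalIntegrable_of_norm_le hGd (D := E)
      fun s hs => hE s (by rw [hs]; exact hc.1) (by rw [hs]; exact hc.2)
  have hlim : ∀ c ∈ Icc a b, Tendsto (fun T : ℝ => ∫ y in (-T)..T, G (c + y * Complex.I)) atTop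
      (𝓝 (∫ y : ℝ, G (c + y * Complex.I))) := fun c hc =>
    intervalIntegral_tendsto_integral (hint c hc) tendsto_neg_atTop_atBot tendsto_id
  have hhor : ∀ ε : ℝ → ℝ, (∀ T, ε T ^ 2 = T ^ 2) →
      Tendsto (fun T : ℝ => ∫ u in a..b, G (u + (ε T : ℝ) * Complex.I)) atTop (𝓝 0) := by
    intro ε hε
    have h0 : Tendsto (fun T : ℝ => E / (1 + T ^ 2) * |b - a|) atTop (𝓝 0) := by
      have h1 : Tendsto (fun T : ℝ => 1 + T ^ 2) atTop atTop :=
        tendsto_atTop_add_const_left _ _ (tendsto_pow_atTop two_ne_zero)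
      simpa using (h1.const_div_atTop E).mul_const |b - a|
    refine squeeze_zero_norm (fun T => ?_) h0
    refine intervalIntegral.norm_integral_le_of_norm_le_const fun u hu => ?_
    rw [uIoc_of_le hab.le] at hu
    have := hE (u + (ε T : ℝ) * Complex.I) (by simpa using hu.1.le) (by simpa using hu.2)
    simpa [hε T] using this
  have hrect : ∀ T : ℝ, (∫ y in (-T)..T, G (b + y * Complex.I)) -
      ∫ y in (-T)..T, G (a + y * Complex.I) =
      Complex.I * ((∫ u in a..b, G (u + ((-T : ℝ) : ℂ) * Complex.I)) -
        ∫ u in a..b, G (u + (T : ℂ) * Complex.I)) := by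
    intro T
    have h1 := Complex.integral_boundary_rect_eq_zero_of_differentiableOn G
      ⟨a, -T⟩ ⟨b, T⟩ hGd.differentiableOn
    simp only [smul_eq_mul] at h1
    linear_combination (-Complex.I) * h1 + ((∫ y in (-T)..T, G (b + y * Complex.I)) -
      ∫ y in (-T)..T, G (a + y * Complex.I)) * Complex.I_sq
  have hz : Tendsto (fun T : ℝ => (∫ y in (-T)..T, G (b + y * Complex.I)) -
      ∫ y in (-T)..T, G (a + y * Complex.I)) atTop (𝓝 0) := by
    simp_rw [hrect]
    have := ((hhor (fun T => -T) (by simp)).sub (hhor (fun T => T) (by simp))).const_mul Complex.I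
    simpa using this
  have heq := tendsto_nhds_unique hz
    ((hlim b ⟨hab.le, le_rfl⟩).sub (hlim a ⟨le_rfl, hab.le⟩))
  simp only [mellinInv, smul_eq_mul]
  congr 1
  exact (sub_eq_zero.1 heq.symm).symm

end AdditiveTwist

namespace AdditiveTwist

/-! ### The functional equation of a pair of twists -/

open Filter Set Topology MeasureTheory

lemma norm_Gamma_le {s : ℂ} (hs : 0 < s.re) : ‖Complex.Gamma s‖ ≤ Real.Gamma s.re := by
  rw [Complex.Gamma_eq_integral hs, Real.Gamma_eq_integral hs, Complex.GammaIntegral]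
  refine (norm_integral_le_integral_norm _).trans_eq
    (setIntegral_congr_fun measurableSet_Ioi fun t ht => ?_)
  rw [mem_Ioi] at ht
  rw [norm_mul, Complex.norm_real, Real.norm_of_nonneg (Real.exp_pos _).le,
    Complex.norm_cpow_eq_rpow_re_of_pos ht, Complex.sub_re, Complex.one_re]

/-- A weak form of Stirling's formula, which suffices for absolute convergence of the inverse Mellin
transform. -/
lemma norm_Gamma_le_div {s : ℂ} (hs : 1 ≤ s.re) :
    ‖Complex.Gamma s‖ ≤ Real.Gamma (s.re + 2) / (1 + s.im ^ 2) := by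
  have h0 : s ≠ 0 := fun h => by rw [h] at hs; norm_num at hs
  have h1 : s + 1 ≠ 0 := fun h => by
    have := congrArg Complex.re h
    simp at this
    linarith
  have h2 : Complex.Gamma (s + 1 + 1) = (s + 1) * (s * Complex.Gamma s) := by
    rw [Complex.Gamma_add_one _ h1, Complex.Gamma_add_one _ h0]
  have h3 := norm_Gamma_le (s := s + 1 + 1) (by simp; linarith)
  rw [h2, norm_mul, norm_mul] at h3
  have h4 : (s + 1 + 1).re = s.re + 2 := by simp; ring
  rw [h4] at h3
  rw [le_div_iff₀ (by positivity)]
  have h5 : 1 + s.im ^ 2 ≤ ‖s‖ ^ 2 := by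
    rw [← Complex.normSq_eq_norm_sq, Complex.normSq_apply]
    nlinarith
  have h6 : ‖s‖ ≤ ‖s + 1‖ := by
    rw [← abs_norm s, ← abs_norm (s + 1), ← sq_le_sq, ← Complex.normSq_eq_norm_sq,
      ← Complex.normSq_eq_norm_sq, Complex.normSq_apply, Complex.normSq_apply]
    simp
    nlinarith
  have h7 : ‖s‖ ^ 2 ≤ ‖s + 1‖ * ‖s‖ := by
    rw [sq]
    gcongr
  nlinarith [norm_nonneg (Complex.Gamma s)]

lemma HasGrowth.exists_norm_completedTwist_le {a : ℕ → ℂ} {σ c : ℝ} (h : HasGrowth a σ)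
    (hσ : 0 < σ) (hc : σ + 1 < c) (x : ℚ) :
    ∃ C ≥ 0, ∀ s : ℂ, s.re = c → ‖completedTwist a x s‖ ≤ C / (1 + s.im ^ 2) := by
  have hsum := summable_norm_div_rpow h hc
  have hterm : ∀ (s : ℂ), s.re = c → ∀ m : ℕ+,
      ‖a m * cexp (2 * Real.pi * Complex.I * (m : ℂ) * (x : ℂ)) / (m : ℂ) ^ s‖ =
        ‖a m‖ / (m : ℝ) ^ c := by
    intro s hs m
    have hm : (0 : ℝ) < (m : ℕ) := Nat.cast_pos.2 m.pos
    rw [norm_div, norm_mul, norm_twist, mul_one, ← Complex.ofReal_natCast,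
      Complex.norm_cpow_eq_rpow_re_of_pos hm, hs]
  have hnn : 0 ≤ ∑' m : ℕ+, ‖a m‖ / (m : ℝ) ^ c := tsum_nonneg fun m => by positivity
  have hG : 0 ≤ Real.Gamma (c + 2) := (Real.Gamma_pos_of_pos (by linarith)).le
  refine ⟨(2 * Real.pi) ^ (-c) * Real.Gamma (c + 2) * ∑' m : ℕ+, ‖a m‖ / (m : ℝ) ^ c,
    by positivity, fun s hs => ?_⟩
  rw [completedTwist, LSeries_eq_tsum_pnat, norm_mul, norm_mul]
  have h1 : ‖(2 * Real.pi : ℂ) ^ (-s)‖ = (2 * Real.pi) ^ (-c) := by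
    rw [show (2 * Real.pi : ℂ) = ((2 * Real.pi : ℝ) : ℂ) by push_cast; rfl,
      Complex.norm_cpow_eq_rpow_re_of_pos (by positivity), Complex.neg_re, hs]
  have h2 := norm_Gamma_le_div (s := s) (by linarith)
  rw [hs] at h2
  have h3 : ‖∑' m : ℕ+, a m * cexp (2 * Real.pi * Complex.I * (m : ℂ) * (x : ℂ)) / (m : ℂ) ^ s‖ ≤
      ∑' m : ℕ+, ‖a m‖ / (m : ℝ) ^ c :=
    tsum_of_norm_bounded hsum.hasSum fun m => (hterm s hs m).le
  rw [h1]
  calc _ ≤ (2 * Real.pi) ^ (-c) * (Real.Gamma (c + 2) / (1 + s.im ^ 2)) *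
        ∑' m : ℕ+, ‖a m‖ / (m : ℝ) ^ c := by gcongr
    _ = _ := by ring

section Relation

variable {φ ψ : ℝ → ℂ} {N : ℝ} {ε : ℂ} {k : ℤ}

lemma inv_mul_inv_mul {N t : ℝ} (hN : 0 < N) : (N * (N * t)⁻¹)⁻¹ = t := by
  field_simp

lemma relation_symm (hN : 0 < N) (hε : ε ≠ 0)
    (h : ∀ t : ℝ, 0 < t → φ (N * t)⁻¹ = ε * (Complex.I * Real.sqrt N * t) ^ k * ψ t) {t : ℝ}
    (ht : 0 < t) :
    ψ (N * t)⁻¹ = ε⁻¹ * (-1) ^ k * (Complex.I * Real.sqrt N * t) ^ k * φ t := by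
  have hs : 0 < Real.sqrt N := Real.sqrt_pos.2 hN
  have hsc : ((Real.sqrt N : ℝ) : ℂ) ≠ 0 := Complex.ofReal_ne_zero.2 hs.ne'
  have htc : (t : ℂ) ≠ 0 := Complex.ofReal_ne_zero.2 ht.ne'
  have h1 := h (N * t)⁻¹ (by positivity)
  rw [inv_mul_inv_mul hN] at h1
  have h2 : Complex.I * Real.sqrt N * ((N * t)⁻¹ : ℝ) = (-1 * (Complex.I * Real.sqrt N * t))⁻¹ := by
    have h3 : (N : ℂ) = Real.sqrt N * Real.sqrt N := by
      rw [← Complex.ofReal_mul, Real.mul_self_sqrt hN.le]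
    push_cast
    rw [h3]
    field_simp
    simp
  rw [h2, inv_zpow, mul_zpow] at h1
  have h4 : (Complex.I * Real.sqrt N * t) ^ k ≠ 0 :=
    zpow_ne_zero _ (mul_ne_zero (mul_ne_zero Complex.I_ne_zero hsc) htc)
  have h5 : (-1 : ℂ) ^ k ≠ 0 := zpow_ne_zero _ (by norm_num)
  rw [h1]
  field_simp

lemma exists_norm_le_of_relation (hN : 0 < N)
    (h : ∀ t : ℝ, 0 < t → φ (N * t)⁻¹ = ε * (Complex.I * Real.sqrt N * t) ^ k * ψ t) {A C : ℝ}
    (hC : ∀ t : ℝ, 0 < t → ‖ψ t‖ ≤ C * t ^ (-A)) :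
    ∃ D : ℝ, ∀ t : ℝ, 0 < t → ‖φ t‖ ≤ D * t ^ (-(k - A)) := by
  refine ⟨‖ε‖ * Real.sqrt N ^ k * C * N ^ (-(k - A)), fun u hu => ?_⟩
  have ht : 0 < (N * u)⁻¹ := by positivity
  have h1 := h _ ht
  have h2 := hC _ ht
  rw [inv_mul_inv_mul hN] at h1
  generalize ht' : (N * u)⁻¹ = t at *
  have h3 : t ^ ((k : ℝ) - A) = N ^ (-(k - A)) * u ^ (-(k - A)) := by
    rw [← Real.mul_rpow hN.le hu.le, Real.rpow_neg (by positivity), ← Real.inv_rpow (by positivity),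
      ht']
  have h4 : ‖(Complex.I * Real.sqrt N * t) ^ k‖ = Real.sqrt N ^ k * t ^ (k : ℝ) := by
    rw [norm_zpow, norm_mul, norm_mul, Complex.norm_I, one_mul, Complex.norm_real,
      Complex.norm_real, Real.norm_of_nonneg (Real.sqrt_nonneg N), Real.norm_of_nonneg ht.le,
      mul_zpow, Real.rpow_intCast]
  rw [h1, norm_mul, norm_mul, h4]
  calc ‖ε‖ * (Real.sqrt N ^ k * t ^ (k : ℝ)) * ‖ψ t‖
      ≤ ‖ε‖ * (Real.sqrt N ^ k * t ^ (k : ℝ)) * (C * t ^ (-A)) := by gcongr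
    _ = ‖ε‖ * Real.sqrt N ^ k * C * t ^ ((k : ℝ) - A) := by
        rw [sub_eq_add_neg, Real.rpow_add ht]
        ring
    _ = _ := by
        rw [h3]
        ring

lemma differentiable_mellin_and_bounded {c : ℝ} (hφ : ContinuousOn φ (Ioi 0))
    (h1 : ∀ A, c < A → ∃ C : ℝ, ∀ t : ℝ, 0 < t → ‖φ t‖ ≤ C * t ^ (-A))
    (h2 : ∀ A, c < A → ∃ C : ℝ, ∀ t : ℝ, 0 < t → ‖φ t‖ ≤ C * t ^ (-(k - A))) :
    Differentiable ℂ (mellin φ) ∧ BoundedInVerticalStrips (mellin φ) := by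
  have key : ∀ r : ℝ, ∃ A B C D : ℝ, A < r ∧ r < B ∧
      (∀ t, 0 < t → ‖φ t‖ ≤ C * t ^ (-A)) ∧ (∀ t, 0 < t → ‖φ t‖ ≤ D * t ^ (-B)) := by
    intro r
    obtain ⟨D, hD⟩ := h1 (max c r + 1) (by linarith [le_max_left c r])
    obtain ⟨C, hC⟩ := h2 (max c (k - r) + 1) (by linarith [le_max_left c (k - r)])
    exact ⟨_, _, C, D, by linarith [le_max_right c (k - r)], by linarith [le_max_right c r], hC, hD⟩
  constructor
  · intro s
    obtain ⟨A, B, C, D, hA, hB, hC, hD⟩ := key s.re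
    exact differentiableAt_mellin_of_norm_le hφ hC hD hA hB
  · have hconv : ∀ r : ℝ, MellinConvergent φ r := by
      intro r
      obtain ⟨A, B, C, D, hA, hB, hC, hD⟩ := key r
      exact mellinConvergent_of_norm_le hφ hC hD (by simpa using hA) (by simpa using hB)
    exact fun α β => exists_norm_mellin_le (hconv α) (hconv β)

end Relation

variable {a b : ℕ → ℂ} {σ N : ℝ} {x y : ℚ} {ε : ℂ} {k : ℤ}

/-- Hecke: a transformation law along vertical half-lines gives the functional equation. -/
theorem functionalEquation_of_relation (ha : HasGrowth a σ) (hb : HasGrowth b σ) (hσ : 0 < σ)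
    (hN : 0 < N) (hε : ε ≠ 0)
    (h : ∀ t : ℝ, 0 < t → verticalRestriction a x (N * t)⁻¹ =
      ε * (Complex.I * Real.sqrt N * t) ^ k * verticalRestriction b y t) :
    ∃ F G : ℂ → ℂ, IsEntireContinuation a σ x F ∧ IsEntireContinuation b σ y G ∧
      BoundedInVerticalStrips F ∧ BoundedInVerticalStrips G ∧
      ∀ s : ℂ, F s = Complex.I ^ k * ε * (N : ℂ) ^ ((k : ℂ) / 2 - s) * G (k - s) := by
  have hφ := ha.continuousOn_verticalRestriction hσ x
  have hψ := hb.continuousOn_verticalRestriction hσ y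
  have a1 : ∀ A, σ + 1 < A → ∃ C : ℝ, ∀ t : ℝ, 0 < t → ‖verticalRestriction a x t‖ ≤ C * t ^ (-A) :=
    fun A hA => (ha.exists_norm_verticalRestriction_le hσ hA x).imp fun C hC => hC.2
  have b1 : ∀ A, σ + 1 < A → ∃ C : ℝ, ∀ t : ℝ, 0 < t → ‖verticalRestriction b y t‖ ≤ C * t ^ (-A) :=
    fun A hA => (hb.exists_norm_verticalRestriction_le hσ hA y).imp fun C hC => hC.2
  have a2 := fun A hA => let ⟨C, hC⟩ := b1 A hA; exists_norm_le_of_relation hN h hC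
  have b2 := fun A hA => let ⟨C, hC⟩ := a1 A hA
    exists_norm_le_of_relation hN (fun t ht => relation_symm hN hε h ht) hC
  obtain ⟨dF, bF⟩ := differentiable_mellin_and_bounded hφ a1 a2
  obtain ⟨dG, bG⟩ := differentiable_mellin_and_bounded hψ b1 b2
  exact ⟨_, _, ⟨dF, fun s hs => ha.mellin_verticalRestriction hσ x hs⟩,
    ⟨dG, fun s hs => hb.mellin_verticalRestriction hσ y hs⟩, bF, bG,
    mellin_functional_equation hN h⟩

/-- Hecke's converse, by Mellin inversion on the two sides of the critical strip. -/
theorem relation_of_functionalEquation (ha : HasGrowth a σ) (hb : HasGrowth b σ) (hσ : 0 < σ)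
    (hN : 0 < N) {F G : ℂ → ℂ} (hF : IsEntireContinuation a σ x F)
    (hG : IsEntireContinuation b σ y G) (bF : BoundedInVerticalStrips F)
    (hFG : ∀ s : ℂ, F s = Complex.I ^ k * ε * (N : ℂ) ^ ((k : ℂ) / 2 - s) * G (k - s)) {t : ℝ}
    (ht : 0 < t) :
    verticalRestriction a x (N * t)⁻¹ =
      ε * (Complex.I * Real.sqrt N * t) ^ k * verticalRestriction b y t := by
  set φ := verticalRestriction a x with hφdef
  set ψ := verticalRestriction b y with hψdef
  set φ₂ : ℝ → ℂ := fun u => ε * (Complex.I * Real.sqrt N * ((N * u)⁻¹ : ℝ)) ^ k * ψ (N * u)⁻¹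
    with hφ₂
  have hφ : ContinuousOn φ (Ioi 0) := ha.continuousOn_verticalRestriction hσ x
  have hψ : ContinuousOn ψ (Ioi 0) := hb.continuousOn_verticalRestriction hσ y
  have hinv : ContinuousOn (fun u : ℝ => (N * u)⁻¹) (Ioi 0) :=
    ContinuousOn.inv₀ (by fun_prop) fun u hu => (mul_pos hN hu).ne'
  have hcont : ContinuousOn φ₂ (Ioi 0) := by
    refine ContinuousOn.mul (continuousOn_const.mul (ContinuousOn.zpow₀ ?_ k fun u hu => Or.inl ?_))
      (hψ.comp hinv fun u hu => ?_)
    · exact continuousOn_const.mul (Complex.continuous_ofReal.comp_continuousOn hinv)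
    · have h1 := mul_pos hN (mem_Ioi.1 hu)
      exact mul_ne_zero (mul_ne_zero Complex.I_ne_zero (Complex.ofReal_ne_zero.2
        (Real.sqrt_pos.2 hN).ne')) (Complex.ofReal_ne_zero.2 (inv_pos.2 h1).ne')
    · exact inv_pos.2 (mul_pos hN (mem_Ioi.1 hu))
  have hrel : ∀ u : ℝ, 0 < u → φ₂ (N * u)⁻¹ = ε * (Complex.I * Real.sqrt N * u) ^ k * ψ u := by
    intro u hu
    simp only [hφ₂]
    rw [inv_mul_inv_mul hN]
  have hmell := mellin_functional_equation hN hrel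
  -- The line `Re s = c` lies in the domain of absolute convergence of `Λ(f, x, s)`, and
  -- `Re s = k - c` is to its left and is mapped into the domain for `g` by `s ↦ k - s`.
  set c : ℝ := σ + 2 + |(k : ℝ)| with hc
  have hk := neg_abs_le (k : ℝ)
  have hk' := le_abs_self (k : ℝ)
  have hc1 : σ + 1 < c := by linarith [abs_nonneg (k : ℝ)]
  have hkc : (k : ℝ) - c < c := by linarith [abs_nonneg (k : ℝ)]
  have hFright : ∀ s : ℂ, s.re = c → mellin φ s = F s := fun s hs => by
    rw [hF.2 s (by linarith), ha.mellin_verticalRestriction hσ x (by linarith)]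
  have hFleft : ∀ s : ℂ, s.re = k - c → mellin φ₂ s = F s := fun s hs => by
    have h1 : ((k : ℂ) - s).re = c := by simp [hs]
    rw [hmell, hFG, hG.2 _ (by linarith), hb.mellin_verticalRestriction hσ y (by linarith)]
  obtain ⟨C₁, hC₁, hb₁⟩ := ha.exists_norm_completedTwist_le hσ hc1 x
  obtain ⟨C₂, hC₂, hb₂⟩ := hb.exists_norm_completedTwist_le hσ hc1 y
  have e1 : ∀ s : ℂ, s.re = c → ‖F s‖ ≤ C₁ / (1 + s.im ^ 2) := fun s hs => by
    rw [hF.2 s (by linarith)]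
    exact hb₁ s hs
  set K : ℝ := ‖ε‖ * N ^ ((k : ℝ) / 2 - (k - c)) with hK
  have hK0 : 0 ≤ K := by positivity
  have e2 : ∀ s : ℂ, s.re = k - c → ‖F s‖ ≤ K * C₂ / (1 + s.im ^ 2) := fun s hs => by
    have h1 : ((k : ℂ) - s).re = c := by simp [hs]
    have h2 := hb₂ _ h1
    have h3 : ((k : ℂ) / 2 - s).re = (k : ℝ) / 2 - (k - c) := by simp [hs]
    rw [hFG, hG.2 _ (by linarith), norm_mul, norm_mul, norm_mul, norm_zpow, Complex.norm_I,
      one_zpow, one_mul, Complex.norm_cpow_eq_rpow_re_of_pos hN, h3, mul_div_assoc]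
    gcongr
    simpa using h2
  obtain ⟨B, hB⟩ := bF (k - c) c
  obtain ⟨D, hD⟩ := exists_norm_le_div_one_add_sq hF.1 hkc (C := max C₁ (K * C₂))
    (le_max_of_le_left hC₁) hB
    (fun s hs => (e2 s hs).trans (by gcongr; exact le_max_right _ _))
    (fun s hs => (e1 s hs).trans (by gcongr; exact le_max_left _ _))
  have hu : 0 < (N * t)⁻¹ := by positivity
  have hshift := mellinInv_eq_mellinInv hF.1 hkc hD hu
  have hcongr : ∀ (θ : ℝ → ℂ) (r : ℝ), (∀ s : ℂ, s.re = r → mellin θ s = F s) →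
      r ∈ Icc ((k : ℝ) - c) c → MellinConvergent θ r → ContinuousOn θ (Ioi 0) →
      θ (N * t)⁻¹ = mellinInv r F (N * t)⁻¹ := by
    intro θ r hr hmem hconv hθ
    have h1 : ∀ v : ℝ, mellin θ (r + v * Complex.I) = F (r + v * Complex.I) :=
      fun v => hr _ (by simp)
    have h2 : VerticalIntegrable (mellin θ) r := by
      have h3 : VerticalIntegrable F r := verticalIntegrable_of_norm_le hF.1
        fun s hs => hD s (by rw [hs]; exact hmem.1) (by rw [hs]; exact hmem.2)
      exact h3.congr (Eventually.of_forall fun v => (h1 v).symm)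
    rw [← mellinInv_mellin_eq r θ hu hconv h2 (hθ.continuousAt (Ioi_mem_nhds hu))]
    simp only [mellinInv, h1]
  obtain ⟨M₁, -, hM₁⟩ := ha.exists_norm_verticalRestriction_le hσ (A := σ + 3 / 2) (by linarith) x
  obtain ⟨M₂, -, hM₂⟩ := ha.exists_norm_verticalRestriction_le hσ (A := c + 1) (by linarith) x
  obtain ⟨M₃, -, hM₃⟩ := hb.exists_norm_verticalRestriction_le hσ (A := σ + 3 / 2) (by linarith) y
  obtain ⟨M₄, -, hM₄⟩ := hb.exists_norm_verticalRestriction_le hσ (A := c + 1) (by linarith) y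
  obtain ⟨L₃, hL₃⟩ := exists_norm_le_of_relation hN hrel hM₃
  obtain ⟨L₄, hL₄⟩ := exists_norm_le_of_relation hN hrel hM₄
  have f1 := hcongr φ c hFright ⟨hkc.le, le_rfl⟩
    (mellinConvergent_of_norm_le hφ hM₁ hM₂ (by simp; linarith [abs_nonneg (k : ℝ)])
      (by simp)) hφ
  have f2 := hcongr φ₂ (k - c) (fun s hs => hFleft s hs) ⟨le_rfl, hkc.le⟩
    (mellinConvergent_of_norm_le hcont hL₄ hL₃ (by simp) (by simp; linarith [abs_nonneg (k : ℝ)]))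
    hcont
  rw [f1, ← hshift, ← f2, hrel t ht]

end AdditiveTwist

namespace AdditiveTwist

/-! ### The slash action of the matrices of the twists and of `W_p` -/

open Filter Set Topology Matrix ModularGroup CongruenceSubgroup

variable {a b : ℕ → ℂ} {σ : ℝ} {k : ℤ} {p : ℕ}

lemma HasGrowth.mdifferentiable_fourierSeries (ha : HasGrowth a σ) (hσ : 0 < σ) :
    MDiff (fourierSeries a) := by
  rw [UpperHalfPlane.mdifferentiable_iff]
  refine (ha.differentiableOn_fourierFun hσ).congr fun z hz => ?_
  rw [Function.comp_apply, fourierSeries_eq, UpperHalfPlane.ofComplex_apply_of_im_pos hz]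

lemma slash_SL_apply (f : ℍ → ℂ) (γ : SL(2, ℝ)) (z : ℍ) :
    (f ∣[k] (γ : GL (Fin 2) ℝ)) z = f (γ • z) * ((γ 1 0 : ℂ) * z + (γ 1 1 : ℂ)) ^ (-k) := by
  rw [ModularForm.slash_apply]
  simp [UpperHalfPlane.σ, UpperHalfPlane.denom]
  exact Or.inl rfl

lemma coe_frickeMatrix (hp : 0 < p) : (frickeMatrix p hp : Matrix (Fin 2) (Fin 2) ℝ) =
    !![0, -(Real.sqrt p)⁻¹; Real.sqrt p, 0] := rfl

lemma coe_frickeMatrix_smul (hp : 0 < p) (z : ℍ) :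
    ((frickeMatrix p hp • z : ℍ) : ℂ) = -1 / (p * z) := by
  have hz := UpperHalfPlane.ne_zero z
  have hs : ((Real.sqrt p : ℝ) : ℂ) ≠ 0 :=
    Complex.ofReal_ne_zero.2 (Real.sqrt_pos.2 (Nat.cast_pos.2 hp)).ne'
  have h3 : (p : ℂ) = Real.sqrt p * Real.sqrt p := by
    rw [← Complex.ofReal_mul, Real.mul_self_sqrt (Nat.cast_nonneg p), Complex.ofReal_natCast]
  rw [UpperHalfPlane.coe_specialLinearGroup_apply, h3]
  simp [coe_frickeMatrix]
  field_simp

lemma slash_fricke_apply (f : ℍ → ℂ) (hp : 0 < p) (z : ℍ) :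
    (f ∣[k] (frickeMatrix p hp : GL (Fin 2) ℝ)) z =
      f (frickeMatrix p hp • z) * (Real.sqrt p * z) ^ (-k) := by
  rw [slash_SL_apply]
  simp [coe_frickeMatrix]

/-- Slashing with the matrix of a twist and with `W_p` carries the vertical half-line
over `c/j`, `c = (ij + 1)/p`, to the one over `-1/j`. -/
lemma slash_twistMatrix_slash_fricke_apply (hp : 0 < p) {i j c : ℤ} (hj : 0 < j)
    (hc : i * j + 1 = p * c) {t : ℝ} (ht : 0 < t) {z : ℍ} {x : ℚ} (hx : x = -1 / (j : ℚ))
    (hz : (z : ℂ) = (c : ℂ) / j + t * Complex.I) :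
    ((fourierSeries a ∣[k] twistMatrix i j) ∣[k] (frickeMatrix p hp : GL (Fin 2) ℝ)) z =
      verticalRestriction a x (((p : ℝ) * (j : ℝ) ^ 2) * t)⁻¹ *
        (Complex.I * Real.sqrt ((p : ℝ) * (j : ℝ) ^ 2) * t) ^ (-k) := by
  have hp0 : (p : ℂ) ≠ 0 := Nat.cast_ne_zero.2 hp.ne'
  have hj0 : (j : ℂ) ≠ 0 := Int.cast_ne_zero.2 hj.ne'
  have ht0 : (t : ℂ) ≠ 0 := Complex.ofReal_ne_zero.2 ht.ne'
  have hz0 := UpperHalfPlane.ne_zero z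
  have hc' : (i : ℂ) * j + 1 = p * c := by exact_mod_cast hc
  have hjR : (0 : ℝ) < j := Int.cast_pos.2 hj
  have hlin : (j : ℂ) * z - c = Complex.I * j * t := by
    rw [hz]
    field_simp
    ring
  have hden : ((i : ℂ) * j + 1) * (-1 / (p * z)) + j = Complex.I * j * t / z := by
    rw [hc', ← hlin]
    field_simp
    ring
  rw [slash_fricke_apply, ModularForm.SL_slash_apply, ModularGroup.denom_apply,
    coe_frickeMatrix_smul, fourierSeries_eq, UpperHalfPlane.coe_specialLinearGroup_apply,
    coe_frickeMatrix_smul]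
  simp only [coe_twistMatrix, Matrix.of_apply, Matrix.cons_val', Matrix.cons_val_zero,
    Matrix.cons_val_one, Matrix.cons_val_fin_one]
  push_cast
  have harg : verticalRestriction a x (((p : ℝ) * (j : ℝ) ^ 2) * t)⁻¹ =
      fourierFun a ((-(i : ℂ) * (-1 / (p * z)) + -1) /
        (((i : ℂ) * j + 1) * (-1 / (p * z)) + j)) := by
    rw [verticalRestriction, hden, hx]
    congr 1
    push_cast
    have hI := Complex.I_ne_zero
    have hzz : (z : ℂ) * j = c + t * j * Complex.I := by
      rw [hz]
      field_simp
    field_simp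
    linear_combination Complex.I_sq - hc' + (p : ℂ) * hzz
  rw [harg, hden, mul_assoc, ← mul_zpow]
  congr 2
  · simp [hden]
  · rw [Real.sqrt_mul (Nat.cast_nonneg p), Real.sqrt_sq hjR.le]
    push_cast
    field_simp

/-- The identity theorem on a vertical half-line. -/
lemma eq_of_eq_on_vertical {f g : ℍ → ℂ} (hf : MDiff f) (hg : MDiff g) (y : ℝ)
    (h : ∀ z : ℍ, z.re = y → f z = g z) : f = g := by
  rw [UpperHalfPlane.mdifferentiable_iff] at hf hg
  have hU : IsOpen {z : ℂ | 0 < z.im} := isOpen_lt continuous_const Complex.continuous_im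
  have hconv : Convex ℝ {z : ℂ | 0 < z.im} := convex_halfSpace_im_gt 0
  have hmem : (y + Complex.I : ℂ) ∈ {z : ℂ | 0 < z.im} := by simp
  have hfreq : ∃ᶠ z in 𝓝[≠] (y + Complex.I : ℂ),
      (f ∘ UpperHalfPlane.ofComplex) z = (g ∘ UpperHalfPlane.ofComplex) z := by
    have ht : Tendsto (fun t : ℝ => (y + t * Complex.I : ℂ)) (𝓝[>] 1)
        (𝓝[≠] (y + Complex.I : ℂ)) := by
      refine tendsto_nhdsWithin_iff.2 ⟨?_, ?_⟩
      · have h1 : Continuous fun t : ℝ => (y + t * Complex.I : ℂ) := by fun_prop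
        have h2 := h1.tendsto 1
        simp only [Complex.ofReal_one, one_mul] at h2
        exact h2.mono_left nhdsWithin_le_nhds
      · filter_upwards [self_mem_nhdsWithin] with t ht heq
        have h3 := congrArg Complex.im heq
        simp at h3
        exact absurd h3 (ne_of_gt ht)
    refine ht.frequently (Eventually.frequently ?_)
    filter_upwards [self_mem_nhdsWithin] with t ht
    have him : 0 < (y + t * Complex.I : ℂ).im := by
      have : (1 : ℝ) < t := ht
      simp
      linarith
    rw [Function.comp_apply, Function.comp_apply, UpperHalfPlane.ofComplex_apply_of_im_pos him]
    refine h _ ?_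
    simp [UpperHalfPlane.re]
  have heq := AnalyticOnNhd.eqOn_of_preconnected_of_frequently_eq (hf.analyticOnNhd hU)
    (hg.analyticOnNhd hU) hconv.isPreconnected hmem hfreq
  funext z
  have := heq z.im_pos
  simpa using this

lemma fricke_slash_injective (hp : 0 < p) {f g : ℍ → ℂ}
    (h : f ∣[k] (frickeMatrix p hp : GL (Fin 2) ℝ) = g ∣[k] (frickeMatrix p hp : GL (Fin 2) ℝ)) :
    f = g := by
  have h1 := congrArg (· ∣[k] (frickeMatrix p hp : GL (Fin 2) ℝ)⁻¹) h
  simpa only [← SlashAction.slash_mul, mul_inv_cancel, SlashAction.slash_one] using h1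

lemma smul_slash_fricke (hp : 0 < p) (c : ℂ) (f : ℍ → ℂ) :
    (c • f) ∣[k] (frickeMatrix p hp : GL (Fin 2) ℝ) =
      c • f ∣[k] (frickeMatrix p hp : GL (Fin 2) ℝ) := by
  funext z
  simp only [slash_fricke_apply, Pi.smul_apply, smul_eq_mul, mul_assoc]

lemma fourierSeries_slash_T (a : ℕ → ℂ) (k : ℤ) : fourierSeries a ∣[k] T = fourierSeries a := by
  funext z
  rw [ModularForm.SL_slash_apply, ModularGroup.denom_apply, UpperHalfPlane.modular_T_smul,
    fourierSeries_eq, fourierSeries_eq, UpperHalfPlane.coe_vadd, Complex.ofReal_one, add_comm,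
    fourierFun_add_one]
  simp [coe_T]

/-- The elements `γ` of `Γ₀(p)` with `f|γ = χ(d) f`. -/
def slashSubgroup (p : ℕ) (k : ℤ) (χ : DirichletCharacter ℂ p) (f : ℍ → ℂ) :
    Subgroup SL(2, ℤ) where
  carrier := {γ | γ ∈ Gamma0 p ∧ f ∣[k] γ = χ ((γ 1 1 : ℤ) : ZMod p) • f}
  one_mem' := ⟨one_mem _, by simp⟩
  mul_mem' := by
    rintro γ δ ⟨h1, h2⟩ ⟨h3, h4⟩
    refine ⟨mul_mem h1 h3, ?_⟩
    rw [Gamma0_mem] at h1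
    rw [SlashAction.slash_mul, h2, ModularForm.SL_smul_slash, h4, smul_smul, ← map_mul]
    congr 2
    simp [Matrix.mul_apply, h1]
  inv_mem' := by
    rintro γ ⟨h1, h2⟩
    refine ⟨inv_mem h1, ?_⟩
    rw [Gamma0_mem] at h1
    have h3 : f = χ ((γ 1 1 : ℤ) : ZMod p) • f ∣[k] γ⁻¹ := by
      rw [← ModularForm.SL_smul_slash, ← h2, ← SlashAction.slash_mul, mul_inv_cancel,
        SlashAction.slash_one]
    have h4 : ((γ 0 0 : ℤ) : ZMod p) * ((γ 1 1 : ℤ) : ZMod p) = 1 := by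
      have h5 := congrArg (Int.cast : ℤ → ZMod p) (Matrix.det_fin_two (γ : Matrix _ _ ℤ))
      rw [Matrix.SpecialLinearGroup.det_coe] at h5
      push_cast at h5
      rw [h1, mul_zero, sub_zero] at h5
      exact h5.symm
    have h6 : ((γ⁻¹ : SL(2, ℤ)) 1 1 : ℤ) = γ 0 0 := by
      rw [Matrix.SpecialLinearGroup.SL2_inv_expl]
      rfl
    nth_rw 2 [h3]
    rw [h6, smul_smul, ← map_mul, h4, map_one, one_smul]

end AdditiveTwist

namespace AdditiveTwist

/-! ### The converse theorem -/

open Filter Set Topology Matrix ModularGroup CongruenceSubgroup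

section Twist

variable {a b : ℕ → ℂ} {σ : ℝ} {k : ℤ} {p : ℕ} {χ : DirichletCharacter ℂ p}

lemma slash_twistMatrix_eq_iff (hp : p.Prime) (ha : HasGrowth a σ) (hb : HasGrowth b σ)
    (hσ : 0 < σ) {q : ℕ} (h1 : 1 ≤ q) (h2 : q < p) (ε : ℂ) :
    (fourierSeries a ∣[k] twistMatrix (qStar p q) q) ∣[k]
        (frickeMatrix p hp.pos : GL (Fin 2) ℝ) = ε • fourierSeries b ↔
      ∀ t : ℝ, 0 < t → verticalRestriction a (-1 / (q : ℚ)) (((p : ℝ) * (q : ℝ) ^ 2) * t)⁻¹ =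
        ε * (Complex.I * Real.sqrt ((p : ℝ) * (q : ℝ) ^ 2) * t) ^ k *
          verticalRestriction b ((((q : ℚ) * qStar p q + 1) / p) / q) t := by
  have : Fact p.Prime := ⟨hp⟩
  have hpR : (0 : ℝ) < p := Nat.cast_pos.2 hp.pos
  have hqR : (0 : ℝ) < q := Nat.cast_pos.2 h1
  obtain ⟨c, hc⟩ := dvd_qStar_mul_add_one (p := p) h1 h2
  have hy : ((((q : ℚ) * qStar p q + 1) / p) / q : ℚ) = (c : ℚ) / (q : ℚ) := by
    have hc' : (qStar p q : ℚ) * q + 1 = p * c := by exact_mod_cast hc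
    have hp0 : (p : ℚ) ≠ 0 := Nat.cast_ne_zero.2 hp.ne_zero
    rw [mul_comm, hc', mul_div_cancel_left₀ _ hp0]
  rw [hy]
  have key : ∀ (t : ℝ) (z : ℍ), 0 < t → (z : ℂ) = (c : ℂ) / (q : ℂ) + t * Complex.I →
      ((((fourierSeries a ∣[k] twistMatrix (qStar p q) q) ∣[k]
        (frickeMatrix p hp.pos : GL (Fin 2) ℝ)) z = (ε • fourierSeries b) z) ↔
      verticalRestriction a (-1 / (q : ℚ)) (((p : ℝ) * (q : ℝ) ^ 2) * t)⁻¹ =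
        ε * (Complex.I * Real.sqrt ((p : ℝ) * (q : ℝ) ^ 2) * t) ^ k *
          verticalRestriction b ((c : ℚ) / (q : ℚ)) t) := by
    intro t z ht hz
    have h3 := slash_twistMatrix_slash_fricke_apply (a := a) (k := k) hp.pos (i := qStar p q)
      (j := q) (c := c) (by exact_mod_cast h1) hc ht (z := z) (x := -1 / (q : ℚ)) (by simp)
      (by simpa using hz)
    have h4 : verticalRestriction b ((c : ℚ) / (q : ℚ)) t = fourierSeries b z := by
      rw [verticalRestriction, fourierSeries_eq, hz]
      push_cast
      rfl
    have h5 : (Complex.I * Real.sqrt ((p : ℝ) * (q : ℝ) ^ 2) * t) ^ k ≠ 0 := by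
      refine zpow_ne_zero _ (mul_ne_zero (mul_ne_zero Complex.I_ne_zero ?_) ?_)
      · exact Complex.ofReal_ne_zero.2 (Real.sqrt_pos.2 (by positivity)).ne'
      · exact Complex.ofReal_ne_zero.2 ht.ne'
    rw [h3, h4, Pi.smul_apply, smul_eq_mul, _root_.zpow_neg, Int.cast_natCast]
    rw [mul_inv_eq_iff_eq_mul₀ h5, mul_right_comm ε]
  constructor
  · intro h t ht
    have him : 0 < ((c : ℂ) / (q : ℂ) + t * Complex.I).im := by
      rw [← Complex.ofReal_intCast, ← Complex.ofReal_natCast, ← Complex.ofReal_div]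
      simpa using ht
    exact (key t ⟨_, him⟩ ht rfl).1 (congrFun h _)
  · intro h
    refine eq_of_eq_on_vertical ?_ ?_ ((c : ℝ) / q) fun z hz => ?_
    · rw [ModularForm.SL_slash]
      exact ((ha.mdifferentiable_fourierSeries hσ).slash k _).slash k _
    · exact (hb.mdifferentiable_fourierSeries hσ).const_smul ε
    · refine (key z.im z z.im_pos ?_).2 (h z.im z.im_pos)
      rw [← Complex.re_add_im (z : ℂ)]
      change ((z.re : ℝ) : ℂ) + _ = _
      rw [hz]
      push_cast
      rfl

theorem twistFunctionalEquation_iff (hp : p.Prime) (ha : HasGrowth a σ) (hb : HasGrowth b σ)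
    (hσ : 0 < σ) {q : ℕ} (h1 : 1 ≤ q) (h2 : q < p) :
    TwistFunctionalEquation p k χ a b σ q ↔
      (fourierSeries a ∣[k] twistMatrix (qStar p q) q) ∣[k]
        (frickeMatrix p hp.pos : GL (Fin 2) ℝ) = χ (q : ZMod p) • fourierSeries b := by
  have : Fact p.Prime := ⟨hp⟩
  have hN : (0 : ℝ) < (p : ℝ) * (q : ℝ) ^ 2 := by
    have hpR : (0 : ℝ) < p := Nat.cast_pos.2 hp.pos
    have hqR : (0 : ℝ) < q := Nat.cast_pos.2 h1
    positivity
  have hNc : (((p : ℝ) * (q : ℝ) ^ 2 : ℝ) : ℂ) = (p : ℂ) * (q : ℂ) ^ 2 := by push_cast; rfl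
  have hχ : χ (q : ZMod p) ≠ 0 :=
    ((isUnit_iff_ne_zero.2 (natCast_ne_zero_of_lt h1 h2)).map χ).ne_zero
  rw [slash_twistMatrix_eq_iff hp ha hb hσ h1 h2]
  constructor
  · rintro ⟨F, G, hF, hG, bF, -, hFG⟩ t ht
    exact relation_of_functionalEquation ha hb hσ hN hF hG bF (by rw [hNc]; exact hFG) ht
  · intro h
    have h3 := functionalEquation_of_relation ha hb hσ hN hχ h
    rw [hNc] at h3
    exact h3

lemma neg_one_mem_slashSubgroup (hχ : χ (-1) = (-1 : ℂ) ^ k) (f : ℍ → ℂ) :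
    -1 ∈ slashSubgroup p k χ f := by
  refine ⟨by rw [Gamma0_mem]; simp, ?_⟩
  funext z
  rw [ModularForm.SL_slash_apply, ModularGroup.denom_apply, ModularGroup.SL_neg_smul, one_smul]
  have hk : ((-1 : ℂ) ^ k)⁻¹ = (-1) ^ k := by
    rw [← _root_.inv_zpow, inv_neg, inv_one]
  simp [hχ, hk, mul_comm]

lemma T_mem_slashSubgroup : T ∈ slashSubgroup p k χ (fourierSeries a) := by
  refine ⟨by rw [Gamma0_mem]; simp [coe_T], ?_⟩
  rw [fourierSeries_slash_T]
  simp [coe_T]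

/-- For `q = 1` the functional equation says `f|W_p = g`, because both `f` and `g` have period
one. -/
lemma slash_fricke_eq_of_one (hp : p.Prime)
    (h : (fourierSeries a ∣[k] twistMatrix (qStar p 1) 1) ∣[k]
      (frickeMatrix p hp.pos : GL (Fin 2) ℝ) = fourierSeries b) :
    fourierSeries a ∣[k] (frickeMatrix p hp.pos : GL (Fin 2) ℝ) = fourierSeries b := by
  have : Fact p.Prime := ⟨hp⟩
  have h1 : (fourierSeries a ∣[k] twistMatrix (qStar p 1) 1) =
      fourierSeries a ∣[k] lowerUnipotent p := by
    rw [← T_mul_twistMatrix_one, SlashAction.slash_mul, fourierSeries_slash_T, qStar_one,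
      Nat.cast_sub hp.one_le, Nat.cast_one]
  rw [h1, ModularForm.SL_slash, ← SlashAction.slash_mul] at h
  have h2 : (lowerUnipotent p : GL (Fin 2) ℝ) * (frickeMatrix p hp.pos : GL (Fin 2) ℝ) *
      (T : GL (Fin 2) ℝ) = (frickeMatrix p hp.pos : GL (Fin 2) ℝ) := by
    have hs : Real.sqrt p ≠ 0 := (Real.sqrt_pos.2 (Nat.cast_pos.2 hp.pos)).ne'
    have hsq : (p : ℝ) = Real.sqrt p * Real.sqrt p := (Real.mul_self_sqrt (Nat.cast_nonneg p)).symm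
    have hsq' : (p : ℝ) * (Real.sqrt p)⁻¹ = Real.sqrt p := by
      nth_rw 1 [hsq]
      field_simp
    ext i j
    fin_cases i <;> fin_cases j <;>
      simp [Matrix.mul_apply, coe_frickeMatrix, coe_lowerUnipotent, coe_T, hsq']
  rw [← h2, SlashAction.slash_mul, h, ← ModularForm.SL_slash, fourierSeries_slash_T]

lemma isZeroAtImInfty_fourierSeries (ha : HasGrowth a σ) (hσ : 0 < σ) :
    IsZeroAtImInfty (fourierSeries a) := by
  obtain ⟨C, -, hC⟩ := ha.exists_norm_fourierFun_le hσ (A := σ + 2) (by linarith)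
  refine squeeze_zero_norm (a := fun z : ℍ => C * z.im ^ (-(σ + 2))) (fun z => hC z z.im_pos) ?_
  have h1 : Tendsto (fun y : ℝ => C * y ^ (-(σ + 2))) atTop (𝓝 0) := by
    simpa using (tendsto_rpow_neg_atTop (y := σ + 2) (by linarith)).const_mul C
  exact h1.comp tendsto_comap

lemma isZeroAtImInfty_slash_S_mul_T_zpow (hp : p.Prime) (hb : HasGrowth b σ) (hσ : 0 < σ)
    (hW : fourierSeries a ∣[k] (frickeMatrix p hp.pos : GL (Fin 2) ℝ) = fourierSeries b) (j : ℤ) :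
    IsZeroAtImInfty (fourierSeries a ∣[k] (S * T ^ j)) := by
  have hpR : (0 : ℝ) < p := Nat.cast_pos.2 hp.pos
  have hs : ((Real.sqrt p : ℝ) : ℂ) ≠ 0 :=
    Complex.ofReal_ne_zero.2 (Real.sqrt_pos.2 hpR).ne'
  have hsq : (p : ℂ) = Real.sqrt p * Real.sqrt p := by
    rw [← Complex.ofReal_mul, Real.mul_self_sqrt (Nat.cast_nonneg p), Complex.ofReal_natCast]
  have him : ∀ z : ℍ, (((z : ℂ) + j) / p).im = z.im / p := by
    intro z
    rw [← Complex.ofReal_natCast, Complex.div_ofReal_im]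
    simp
  -- `f|S` is a multiple of `z ↦ g(z/p)`, since `W_p = S · diag(√p, 1/√p)`.
  have hval : ∀ z : ℍ, (fourierSeries a ∣[k] (S * T ^ j)) z =
      (Real.sqrt p : ℂ) ^ (-k) * fourierFun b (((z : ℂ) + j) / p) := by
    intro z
    have hpos : 0 < (((z : ℂ) + j) / p).im := by
      rw [him]
      exact div_pos z.im_pos hpR
    set w : ℍ := ⟨((z : ℂ) + j) / p, hpos⟩ with hw
    have hwc : (w : ℂ) = ((z : ℂ) + j) / p := rfl
    have hw0 := UpperHalfPlane.ne_zero w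
    have hzj : (z : ℂ) + j ≠ 0 := fun h => hw0 (by rw [hwc, h, zero_div])
    have h1 := congrFun hW w
    rw [slash_fricke_apply, fourierSeries_eq, fourierSeries_eq, coe_frickeMatrix_smul, hwc] at h1
    have h2 : (-1 : ℂ) / (p * (((z : ℂ) + j) / p)) = -1 / ((z : ℂ) + j) := by
      have : (p : ℂ) ≠ 0 := Nat.cast_ne_zero.2 hp.ne_zero
      field_simp
    have h3 : (Real.sqrt p : ℂ) * (((z : ℂ) + j) / p) = ((z : ℂ) + j) / Real.sqrt p := by
      rw [hsq]
      field_simp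
    rw [h2, h3] at h1
    rw [← h1, ModularForm.SL_slash_apply, ModularGroup.denom_apply, fourierSeries_eq,
      UpperHalfPlane.coe_specialLinearGroup_apply, coe_S_mul_T_zpow]
    simp only [Matrix.of_apply, Matrix.cons_val', Matrix.cons_val_zero,
      Matrix.cons_val_one, Matrix.cons_val_fin_one]
    simp only [map_zero, map_neg, map_one, eq_intCast, Int.cast_one, Complex.ofReal_zero,
      Complex.ofReal_neg, Complex.ofReal_one, zero_mul, zero_add, one_mul, Complex.ofReal_intCast]
    rw [mul_left_comm, ← mul_zpow, mul_div_cancel₀ _ hs]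
  obtain ⟨C, -, hC⟩ := hb.exists_norm_fourierFun_le hσ (A := σ + 2) (by linarith)
  refine squeeze_zero_norm
    (a := fun z : ℍ => ‖(Real.sqrt p : ℂ) ^ (-k)‖ * (C * (z.im / p) ^ (-(σ + 2))))
    (fun z => ?_) ?_
  · rw [hval, norm_mul]
    gcongr
    have h1 := hC (((z : ℂ) + j) / p) (by rw [him]; exact div_pos z.im_pos hpR)
    rwa [him] at h1
  · have h1 : Tendsto (fun y : ℝ => ‖(Real.sqrt p : ℂ) ^ (-k)‖ * (C * (y / p) ^ (-(σ + 2))))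
        atTop (𝓝 0) := by
      have h2 := (tendsto_rpow_neg_atTop (y := σ + 2) (by linarith)).comp
        (tendsto_id.atTop_div_const hpR)
      simpa using (h2.const_mul C).const_mul ‖(Real.sqrt p : ℂ) ^ (-k)‖
    exact h1.comp tendsto_comap

theorem isCuspFormWithChar_of_twists (hp : p.Prime) (h3 : 3 < p) (hχ : χ (-1) = (-1 : ℂ) ^ k)
    (ha : HasGrowth a σ) (hb : HasGrowth b σ) (hσ : 0 < σ)
    (h : ∀ q ∈ twistSet p, (fourierSeries a ∣[k] twistMatrix (qStar p q) q) ∣[k]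
      (frickeMatrix p hp.pos : GL (Fin 2) ℝ) = χ (q : ZMod p) • fourierSeries b) :
    IsCuspFormWithChar p k χ (fourierSeries a) ∧
      fourierSeries a ∣[k] (frickeMatrix p hp.pos : GL (Fin 2) ℝ) = fourierSeries b := by
  have : Fact p.Prime := ⟨hp⟩
  have hW : fourierSeries a ∣[k] (frickeMatrix p hp.pos : GL (Fin 2) ℝ) = fourierSeries b := by
    refine slash_fricke_eq_of_one hp ?_
    simpa using h 1 one_mem_twistSet
  have hneg := neg_one_mem_slashSubgroup hχ (fourierSeries a)
  have hT : T ∈ slashSubgroup p k χ (fourierSeries a) := T_mem_slashSubgroup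
  have hQ : ∀ q ∈ twistSet p,
      twistMatrix (qStar p q) q ∈ slashSubgroup p k χ (fourierSeries a) := by
    intro q hq
    have hb := bounds_of_mem_twistSet h3 hq
    refine ⟨twistMatrix_mem_Gamma0 (dvd_qStar_mul_add_one hb.1 (by omega)),
      fricke_slash_injective (k := k) hp.pos ?_⟩
    rw [h q hq, smul_slash_fricke, hW]
    simp [coe_twistMatrix]
  have hle : slashSubgroup p k χ (fourierSeries a) ≤ Gamma0 p := fun γ hγ => hγ.1
  refine ⟨⟨ha.mdifferentiable_fourierSeries hσ,
    fun γ hγ => (Gamma0_le_of_twists hle hneg hT hQ hγ).2, fun τ => ?_⟩, hW⟩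
  have hsmul : ∀ (c : ℂ) (f : ℍ → ℂ), IsZeroAtImInfty f → IsZeroAtImInfty (c • f) := by
    intro c f hf
    have : Tendsto (fun z => c * f z) atImInfty (𝓝 (c * 0)) := Tendsto.const_mul c hf
    rwa [mul_zero] at this
  rcases mem_or_exists_eq_mul_S_mul_T_zpow hneg hT hQ τ with hτ | ⟨γ, hγ, j, rfl⟩
  · rw [hτ.2]
    exact hsmul _ _ (isZeroAtImInfty_fourierSeries ha hσ)
  · rw [SlashAction.slash_mul, hγ.2, ModularForm.SL_smul_slash]
    exact hsmul _ _ (isZeroAtImInfty_slash_S_mul_T_zpow hp hb hσ hW j)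

end Twist

end AdditiveTwist

theorem theorem2 :
    ∃ Q : ℕ → Finset ℕ, AdditiveTwist.ComputableFinsets Q ∧
      ∀ (p : ℕ) (hp : p.Prime), 3 < p →
        (Q p).card = 2 * (p / 12) + 3 ∧
        (∀ q ∈ Q p, 1 ≤ q ∧ q ≤ p - 2) ∧
        ∀ (k : ℤ) (χ : DirichletCharacter ℂ p), χ (-1) = (-1 : ℂ) ^ k →
        ∀ (a b : ℕ → ℂ) (σ : ℝ), 0 < σ →
          AdditiveTwist.HasGrowth a σ → AdditiveTwist.HasGrowth b σ →
          ((AdditiveTwist.IsCuspFormWithChar p k χ (AdditiveTwist.fourierSeries a) ∧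
              AdditiveTwist.fourierSeries a ∣[k]
                  (AdditiveTwist.frickeMatrix p hp.pos : GL (Fin 2) ℝ) =
                AdditiveTwist.fourierSeries b) ↔
            ∀ q ∈ Q p, AdditiveTwist.TwistFunctionalEquation p k χ a b σ q) := by
  refine ⟨AdditiveTwist.twistSet, AdditiveTwist.computableFinsets_twistSet, fun p hp h3 => ?_⟩
  have : Fact p.Prime := ⟨hp⟩
  refine ⟨AdditiveTwist.card_twistSet h3, fun q hq => AdditiveTwist.bounds_of_mem_twistSet h3 hq,
    fun k χ hχ a b σ hσ ha hb => ?_⟩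
  have key : (∀ q ∈ AdditiveTwist.twistSet p,
      AdditiveTwist.TwistFunctionalEquation p k χ a b σ q) ↔ _ :=
    forall₂_congr fun q hq =>
      have hq' := AdditiveTwist.bounds_of_mem_twistSet h3 hq
      AdditiveTwist.twistFunctionalEquation_iff hp ha hb hσ hq'.1 (by omega)
  rw [key]
  refine ⟨fun ⟨hf, hW⟩ q hq => ?_,
    AdditiveTwist.isCuspFormWithChar_of_twists hp h3 hχ ha hb hσ⟩
  have hq' := AdditiveTwist.bounds_of_mem_twistSet h3 hq
  have hmem := AdditiveTwist.twistMatrix_mem_Gamma0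
    (AdditiveTwist.dvd_qStar_mul_add_one (p := p) hq'.1 (by omega))
  have hslash : AdditiveTwist.fourierSeries a ∣[k] AdditiveTwist.twistMatrix
      (AdditiveTwist.qStar p q) q = χ (q : ZMod p) • AdditiveTwist.fourierSeries a := by
    rw [hf.slash_eq _ hmem]
    simp [AdditiveTwist.coe_twistMatrix]
    rfl
  rw [hslash, AdditiveTwist.smul_slash_fricke, hW]
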